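/- Let $X$ be a locally compact Hausdorff space with countable base. A boundary kernel for an open set $U\subset X$ is a kernel $T$ on $X$ such that $T(x,X\setminus\partial U)=0$ for $x\in U$ and $T(x,\cdot)=\varepsilon_x$ (the Dirac measure) for $x\notin U$. Let $\mathcal V$ be a base of the topology of $X$ consisting of relatively compact open sets and, for each $V\in\mathcal V$, let $H_V$ be a boundary kernel for $V$; write $H_Vf(x)=\int f\,dH_V(x,\cdot)$. For open $U$ let $\mathcal V(U)=\{W\in\mathcal V:\overline W\subset U\}$. A local choice in $U$ is a map assigning to each $x\in U$ a fundamental system $\mathcal W(x)\subset\mathcal V(U)$ of neighborhoods of $x$. A lower semicontinuous $u:U\to(-\infty,\infty]$ is $\mathcal W$-hyperharmonic on $U$ if $H_Wu(x)\le u(x)$ for all $x\in U$ and $W\in\mathcal W(x)$; it is hyperharmonic on $U$ if this holds for all $W\in\mathcal V(U)$ and $x\in W$. A continuous $h:U\to\mathbb R$ is harmonic on $U$ if $H_Vh=h$ for all $V\in\mathcal V(U)$. A hyperharmonic $s$ on $U$ is superharmonic if $H_Vs$ is locally bounded on $V$ for every $V\in\mathcal V(U)$. An open set $U$ is a $\mathcal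 P$-set if the positive (that is, $\ge 0$) hyperharmonic functions on $U$ separate the points of $U$. Suppose that $(H_V)_{V\in\mathcal V}$ is a normal Bauer family of harmonic boundary kernels, that is, for every $V\in\mathcal V$: $(H_1)$ $H_WH_V=H_V$ for all $W\in\mathcal V$ with $W\subset V$; $(H_2)$ $H_Vf$ is continuous on $X$ for every continuous $f:X\to\mathbb R$, and $H_V1=1$; $(H_3)$ there is a local choice $\mathcal W$ in $V$ such that the positive $\mathcal W$-hyperharmonic functions on $V$ separate the points of $V$; $(H_4)$ $H_Vf$ is continuous on $V$ for every bounded Borel function $f$ on $X$. Suppose also that the family is elliptic: every harmonic function $h\ge0$ on a connected open set $U$ is identically zero or strictly positive on $U$. A compact $K\subset X$ contained in a $\mathcal P$-set is stable if for every $z\in\partial K$ there are an open neighborhood $N$ of $z$ and a strictly positive superharmonic function $s$ on $N\setminus K$ with $\lim_{x\to z}s(x)=0$. A compact $K\neq\emptyset$ is strongly stable if there are a $\mathcal P$-set $W'\supset K$ and a strictly positive harmonic function $h$ on $W'\setminus K$ with $\lim_{x\to z}h(x)=0$ for every $z\in\partial K$. **Proposition.** Let $K\neq\emptyset$ be a stable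 compact contained in a $\mathcal P$-set $W$. Then $K$ is strongly stable if and only if $K$ has at most finitely many holes, that is, there are only finitely many connected components $V$ of $W\setminus K$ which are relatively compact in $W$ (that is, $\overline V$ is compact and contained in $W$). Moreover, for a connected component $V$ of $W\setminus K$, being relatively compact in $W$ is equivalent to having compact closure in $X$ with $\partial V\subset K$. -/

import Mathlib

open Set Filter Topology MeasureTheory ProbabilityTheory

namespace Bauer

/-- The integral of an extended real valued function, as the integral of the positive part minus
the integral of the negative part. It is used only for functions which are bounded below almost
everywhere, and for probability measures, so the negative part always has a finite integral. -/
noncomputable def eintegral {X : Type*} [MeasurableSpace X] (μ : Measure X) (u : X → EReal) :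
    EReal :=
  ((∫⁻ x, (u x).toENNReal ∂μ : ENNReal) : EReal) - ((∫⁻ x, (-u x).toENNReal ∂μ : ENNReal) : EReal)

section Families

variable {X : Type*} [TopologicalSpace X] [MeasurableSpace X]

/-- `T` is a boundary kernel for `U`: for `x ∈ U` the measure `T x` does not charge the complement
of the boundary of `U`, and for `x ∉ U` it is the Dirac measure at `x`. -/
def IsBoundaryKernel (T : Kernel X X) (U : Set X) : Prop :=
  (∀ x ∈ U, T x (frontier U)ᶜ = 0) ∧ ∀ x, x ∉ U → T x = Measure.dirac x

/-- The members of `𝒱` whose closure is contained in `U`. -/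
def inside (𝒱 : Set (Set X)) (U : Set X) : Set (Set X) :=
  {W | W ∈ 𝒱 ∧ closure W ⊆ U}

/-- `𝒲` is a local choice from `𝒱` in `U`: for each `x ∈ U`, `𝒲 x` is a fundamental system of
neighborhoods of `x` consisting of members of `𝒱` with closure in `U`. -/
def IsLocalChoice (𝒱 : Set (Set X)) (U : Set X) (𝒲 : X → Set (Set X)) : Prop :=
  ∀ x ∈ U, (∀ W ∈ 𝒲 x, W ∈ inside 𝒱 U ∧ x ∈ W) ∧ ∀ N ∈ 𝓝 x, ∃ W ∈ 𝒲 x, W ⊆ N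

/-- `u` is `𝒲`-hyperharmonic on `U`. Functions on `U` are represented by functions on all of `X`;
only the values on `U` matter. -/
def HyperharmonicFor (H : Set X → Kernel X X) (𝒲 : X → Set (Set X)) (U : Set X) (u : X → EReal) :
    Prop :=
  LowerSemicontinuousOn u U ∧ (∀ x ∈ U, u x ≠ ⊥) ∧
    ∀ x ∈ U, ∀ W ∈ 𝒲 x, eintegral (H W x) u ≤ u x

/-- `u` is hyperharmonic on `U`: all members of `𝒱` with closure in `U` are taken into account. -/
def Hyperharmonic (𝒱 : Set (Set X)) (H : Set X → Kernel X X) (U : Set X) (u : X → EReal) : Prop :=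
  HyperharmonicFor H (fun x => {W | W ∈ inside 𝒱 U ∧ x ∈ W}) U u

/-- The functions in `F` which are positive on `U` separate the points of `U`. -/
def PosSeparates (F : Set (X → EReal)) (U : Set X) : Prop :=
  ∀ x ∈ U, ∀ y ∈ U, x ≠ y → ∃ u ∈ F, (∀ z ∈ U, 0 ≤ u z) ∧ u x ≠ u y

/-- `h` is harmonic on `U` (real valued; only the values on `U` matter). -/
def Harmonic (𝒱 : Set (Set X)) (H : Set X → Kernel X X) (U : Set X) (h : X → ℝ) : Prop :=
  ContinuousOn h U ∧ ∀ V ∈ inside 𝒱 U, ∀ x ∈ U, ∫ y, h y ∂(H V x) = h x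

/-- `s` is superharmonic on `U`: it is hyperharmonic on `U` and, for each member `V` of `𝒱` with
closure in `U`, the function `x ↦ ∫ s d(H V x)` is locally bounded on `V`. -/
def Superharmonic (𝒱 : Set (Set X)) (H : Set X → Kernel X X) (U : Set X) (s : X → EReal) : Prop :=
  Hyperharmonic 𝒱 H U s ∧
    ∀ V ∈ inside 𝒱 U, ∀ x ∈ V, ∃ M : ℝ, ∀ᶠ y in 𝓝[V] x,
      ((-M : ℝ) : EReal) ≤ eintegral (H V y) s ∧ eintegral (H V y) s ≤ (M : EReal)

/-- `(H V)`, `V ∈ 𝒱`, is a normal Bauer family of harmonic boundary kernels: `𝒱` is a base of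
relatively compact open sets and each `H V`, `V ∈ 𝒱`, is a boundary kernel for `V`, such that
`H1` - `H4` hold. The values `H V` for `V ∉ 𝒱` are irrelevant. -/
structure IsNormalBauerFamily (𝒱 : Set (Set X)) (H : Set X → Kernel X X) : Prop where
  isBasis : TopologicalSpace.IsTopologicalBasis 𝒱
  isCompact_closure : ∀ V ∈ 𝒱, IsCompact (closure V)
  boundary : ∀ V ∈ 𝒱, IsBoundaryKernel (H V) V
  /-- The kernel `H W` followed by `H V`, in the order of Mathlib's composition. -/
  H1 : ∀ V ∈ 𝒱, ∀ W ∈ 𝒱, W ⊆ V → (H V) ∘ₖ (H W) = H V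
  H2_continuous : ∀ V ∈ 𝒱, ∀ f : X → ℝ, Continuous f → Continuous fun x => ∫ y, f y ∂(H V x)
  H2_normal : ∀ V ∈ 𝒱, ∀ x, H V x univ = 1
  H3 : ∀ V ∈ 𝒱, ∃ 𝒲 : X → Set (Set X), IsLocalChoice 𝒱 V 𝒲 ∧
    PosSeparates {u | HyperharmonicFor H 𝒲 V u} V
  H4 : ∀ V ∈ 𝒱, ∀ f : X → ℝ, Measurable f → (∃ C : ℝ, ∀ x, |f x| ≤ C) →
    ContinuousOn (fun x => ∫ y, f y ∂(H V x)) V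

/-- The family is elliptic: each positive harmonic function on a connected open set is identically
zero or strictly positive. -/
def IsElliptic (𝒱 : Set (Set X)) (H : Set X → Kernel X X) : Prop :=
  ∀ U : Set X, IsOpen U → IsConnected U → ∀ h : X → ℝ, Harmonic 𝒱 H U h → (∀ x ∈ U, 0 ≤ h x) →
    (∀ x ∈ U, h x = 0) ∨ ∀ x ∈ U, 0 < h x

/-- `U` is a `𝒫`-set: an open set whose points are separated by the positive hyperharmonic
functions on it. -/
def IsPSet (𝒱 : Set (Set X)) (H : Set X → Kernel X X) (U : Set X) : Prop :=
  IsOpen U ∧ PosSeparates {u | Hyperharmonic 𝒱 H U u} U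

/-- `K` is a stable compact. -/
def IsStable (𝒱 : Set (Set X)) (H : Set X → Kernel X X) (K : Set X) : Prop :=
  IsCompact K ∧ (∃ W, IsPSet 𝒱 H W ∧ K ⊆ W) ∧
    ∀ z ∈ frontier K, ∃ W : Set X, IsOpen W ∧ z ∈ W ∧ ∃ s : X → EReal,
      Superharmonic 𝒱 H (W \ K) s ∧ (∀ x ∈ W \ K, 0 < s x) ∧ Tendsto s (𝓝[W \ K] z) (𝓝 0)

/-- `K` is a strongly stable compact. -/
def IsStronglyStable (𝒱 : Set (Set X)) (H : Set X → Kernel X X) (K : Set X) : Prop :=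
  IsCompact K ∧ K.Nonempty ∧ ∃ W, IsPSet 𝒱 H W ∧ K ⊆ W ∧ ∃ h : X → ℝ,
    Harmonic 𝒱 H (W \ K) h ∧ (∀ x ∈ W \ K, 0 < h x) ∧
      ∀ z ∈ frontier K, Tendsto h (𝓝[W \ K] z) (𝓝 0)

end Families

/-- The connected components of the subset `A` of `X`. -/
def components {X : Type*} [TopologicalSpace X] (A : Set X) : Set (Set X) :=
  {V | ∃ x ∈ A, V = connectedComponentIn A x}

/-- The holes of `K` in `W`: the connected components of `W \ K` which are relatively compact
in `W`. -/
def holes {X : Type*} [TopologicalSpace X] (W K : Set X) : Set (Set X) :=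
  {V | V ∈ components (W \ K) ∧ IsCompact (closure V) ∧ closure V ⊆ W}

end Bauer

/-!
A nonempty relatively compact open subset of a `𝒫`-set carries no strictly positive harmonic
function vanishing at the boundary. Let `A` be an open neighborhood of `K` with compact closure.
The components of `W \ K` meeting the compact set `frontier A` are finite in number, and a hole
which avoids `frontier A` lies in `A`. If `A` is contained in the domain of a harmonic function
witnessing strong stability, there is no such hole. Conversely, if `K` has finitely many holes, only
finitely many components meet `A`. Let `B` be an open set with closure in `W \ K` meeting each of
them, and consider the smallest positive hyperharmonic function on `W \ K` which is at least `1` on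
`B`. It is harmonic off the closure of `B`, strictly positive near `K` by ellipticity, and tends to
zero at `z ∈ frontier K`: if `s` is the local function from stability and `V` a small neighborhood
of `z`, it is dominated on `V` by `x ↦ H V x O + c * s x`, where `O` is the complement of the union
of `K` and of a compact subset of `frontier V \ K` such that `H V z O` is small.
-/

namespace Bauer

section SemicontinuousFunctions

variable {X : Type*} [TopologicalSpace X]

theorem exists_continuous_le_of_lt [T2Space X] [LocallyCompactSpace X] {u : X → ENNReal} {z : X}
    (hu : LowerSemicontinuousAt u z) {a : ENNReal} (ha : a < u z) :
    ∃ f : X → ENNReal, Continuous f ∧ (∀ x, f x ≠ ⊤) ∧ f ≤ u ∧ a < f z := by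
  obtain ⟨b, hab, hbu⟩ := exists_between ha
  obtain ⟨O, hOu, hO, hzO⟩ := mem_nhds_iff.1 (hu b hbu)
  obtain ⟨g, hg1, hg0, -, hg⟩ := exists_continuous_one_zero_of_isCompact
    (isCompact_singleton (x := z)) hO.isClosed_compl (by simpa using hzO)
  have hb : b ≠ ⊤ := hbu.ne_top
  refine ⟨fun x => b * ENNReal.ofReal (g x),
    (ENNReal.continuous_const_mul hb).comp (ENNReal.continuous_ofReal.comp g.continuous),
    fun x => ENNReal.mul_ne_top hb ENNReal.ofReal_ne_top, fun x => ?_,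
    by simpa [show g z = 1 from hg1 rfl] using hab⟩
  by_cases hx : x ∈ O
  · calc b * ENNReal.ofReal (g x) ≤ b * 1 := by gcongr; simpa using (hg x).2
      _ ≤ u x := (mul_one b).trans_le (hOu hx).le
  · simp [show g x = 0 from hg0 hx]

theorem lintegral_le_of_isLUB [HereditarilyLindelofSpace X] [MeasurableSpace X]
    [OpensMeasurableSpace X] {μ : Measure X} {𝓕 : Set (X → ENNReal)} {u : X → ENNReal}
    (hlsc : ∀ f ∈ 𝓕, LowerSemicontinuous f) (hsup : SupClosed 𝓕) (hu : IsLUB 𝓕 u) {a : ENNReal}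
    (ha : ∀ f ∈ 𝓕, ∫⁻ x, f x ∂μ ≤ a) : ∫⁻ x, u x ∂μ ≤ a := by
  obtain ⟨𝓕', h𝓕', hcount, hlub⟩ := exists_countable_lowerSemicontinuous_isLUB hlsc hu
  rcases 𝓕'.eq_empty_or_nonempty with rfl | hne
  · simp [isLUB_empty_iff.1 hlub |>.eq_bot]
  obtain ⟨f, rfl⟩ := hcount.exists_eq_range hne
  have hp : ∀ n, partialSups f n ∈ 𝓕 := fun n => by
    induction n with
    | zero => simpa using h𝓕' (mem_range_self 0)
    | succ n ih => exact partialSups_add_one f n ▸ hsup ih (h𝓕' (mem_range_self (n + 1)))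
  have hup : u = ⨆ n, partialSups f n := by
    rw [iSup_partialSups_eq, ← hlub.sSup_eq, sSup_range]
  simp_rw [hup, iSup_apply]
  rw [lintegral_iSup (fun n => (hlsc _ (hp n)).measurable) (partialSups f).mono]
  exact iSup_le fun n => ha _ (hp n)

theorem exists_continuous_lt_lintegral [T2Space X] [LocallyCompactSpace X]
    [HereditarilyLindelofSpace X] [MeasurableSpace X] [OpensMeasurableSpace X] {μ : Measure X}
    {u : X → ENNReal} (hu : LowerSemicontinuous u) {a : ENNReal} (ha : a < ∫⁻ x, u x ∂μ) :
    ∃ f : X → ENNReal, Continuous f ∧ (∀ x, f x ≠ ⊤) ∧ f ≤ u ∧ a < ∫⁻ x, f x ∂μ := by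
  by_contra! hcon
  refine ha.not_ge (lintegral_le_of_isLUB
    (𝓕 := {f | Continuous f ∧ (∀ x, f x ≠ ⊤) ∧ f ≤ u}) (fun f hf => hf.1.lowerSemicontinuous)
    ?_ ⟨fun f hf => hf.2.2, fun v hv x => ?_⟩ fun f hf => hcon f hf.1 hf.2.1 hf.2.2)
  · rintro f ⟨hf, hft, hfu⟩ g ⟨hg, hgt, hgu⟩
    exact ⟨hf.sup hg, fun x => max_ne_top (hft x) (hgt x), sup_le hfu hgu⟩
  · by_contra! hx
    obtain ⟨f, hf, hft, hfu, hfx⟩ := exists_continuous_le_of_lt (hu x) hx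
    exact (hv ⟨hf, hft, hfu⟩ x).not_gt hfx

theorem lowerSemicontinuousAt_of_isOpen {Y : Type*} [Preorder Y] {s : X → Y} {U : Set X}
    (hs : LowerSemicontinuousOn s U) (hU : IsOpen U) {x : X} (hx : x ∈ U) :
    LowerSemicontinuousAt s x := fun a ha => by
  simpa only [hU.nhdsWithin_eq hx] using hs x hx a ha

theorem lowerSemicontinuousOn_piecewise_inf {Y : Type*} [LinearOrder Y] {U V : Set X}
    [∀ x, Decidable (x ∈ V)] (hU : IsOpen U) (hV : IsOpen V) {p q : X → Y}
    (hq : LowerSemicontinuousOn q U) (hp : LowerSemicontinuousOn p (U ∩ V))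
    (hpq : ∀ z ∈ U ∩ frontier V, ∀ a < q z, ∀ᶠ y in 𝓝[V] z, a < p y) :
    LowerSemicontinuousOn (V.piecewise (q ⊓ p) q) U := by
  refine fun x hx => LowerSemicontinuousAt.lowerSemicontinuousWithinAt _ fun a ha => ?_
  change a < _ at ha
  by_cases hxV : x ∈ V
  · rw [piecewise_eq_of_mem _ _ _ hxV] at ha
    have hqp := (lowerSemicontinuousAt_of_isOpen hq hU hx).inf
      (lowerSemicontinuousAt_of_isOpen hp (hU.inter hV) ⟨hx, hxV⟩)
    filter_upwards [hqp a ha, hV.mem_nhds hxV] with y hy hyV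
    rwa [piecewise_eq_of_mem _ _ _ hyV]
  · rw [piecewise_eq_of_notMem _ _ _ hxV] at ha
    have hpV : ∀ᶠ y in 𝓝 x, y ∈ V → a < p y := by
      by_cases hxc : x ∈ closure V
      · exact eventually_nhdsWithin_iff.1 (hpq x ⟨hx, hV.frontier_eq ▸ ⟨hxc, hxV⟩⟩ a ha)
      · filter_upwards [isClosed_closure.isOpen_compl.mem_nhds hxc] with y hy hyV using
          absurd (subset_closure hyV) hy
    filter_upwards [lowerSemicontinuousAt_of_isOpen hq hU hx a ha, hpV] with y hyq hyp
    by_cases hyV : y ∈ V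
    · rw [piecewise_eq_of_mem _ _ _ hyV]
      exact lt_inf_iff.2 ⟨hyq, hyp hyV⟩
    · rwa [piecewise_eq_of_notMem _ _ _ hyV]

open scoped Classical in
theorem lowerSemicontinuous_piecewise_top {F : Set X} (hF : IsClosed F) {w : X → ENNReal}
    (hw : LowerSemicontinuousOn w F) : LowerSemicontinuous (F.piecewise w ⊤) := by
  intro x a ha
  by_cases hx : x ∈ F
  · rw [piecewise_eq_of_mem _ _ _ hx] at ha
    filter_upwards [eventually_nhdsWithin_iff.1 (hw x hx a ha)] with y hy
    by_cases hyF : y ∈ F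
    · simpa only [piecewise_eq_of_mem _ _ _ hyF] using hy hyF
    · exact (piecewise_eq_of_notMem F w ⊤ hyF).symm ▸ ha.trans_le le_top
  · rw [piecewise_eq_of_notMem _ _ _ hx] at ha
    filter_upwards [hF.isOpen_compl.mem_nhds hx] with y hy
    rwa [piecewise_eq_of_notMem _ _ _ hy]

theorem eventually_lt_add {f w : X → ENNReal} {S : Set X} {z : X} {ε : ENNReal}
    (hf : ContinuousWithinAt f S z) (hw : LowerSemicontinuousWithinAt w S z)
    (hlt : f z < w z + ε) : ∀ᶠ y in 𝓝[S] z, f y < w y + ε := by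
  obtain ⟨t, hft, htw⟩ := exists_between hlt
  have hwε : LowerSemicontinuousWithinAt (fun y => w y + ε) S z :=
    (continuous_add_const ε).continuousAt.comp_lowerSemicontinuousWithinAt hw
      fun _ _ h => add_le_add_left h ε
  filter_upwards [hf.eventually_lt_const hft, hwε t htw] with y h1 h2 using h1.trans h2

theorem upperSemicontinuous_indicator_sub {G : Set X} (hG : IsOpen G) {f w : X → ENNReal}
    (hf : ContinuousOn f G) (hf_top : ∀ x ∈ G, f x ≠ ⊤) (hw : LowerSemicontinuousOn w G)
    (hb : ∀ z ∈ frontier G, ∀ ε, 0 < ε → ∀ᶠ x in 𝓝[G] z, f x ≤ w x + ε) :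
    UpperSemicontinuous (G.indicator (f - w)) := by
  intro x b hxb
  obtain ⟨c, hxc, hcb⟩ := exists_between hxb
  suffices h : ∀ᶠ y in 𝓝[G] x, f y ≤ w y + c by
    filter_upwards [eventually_nhdsWithin_iff.1 h] with y hy
    by_cases hyG : y ∈ G
    · exact (indicator_of_mem hyG (f - w)).trans_lt ((tsub_le_iff_left.2 (hy hyG)).trans_lt hcb)
    · exact (indicator_of_notMem hyG (f - w)).trans_lt (bot_le.trans_lt hcb)
  by_cases hxG : x ∈ G
  · rw [indicator_of_mem hxG, Pi.sub_apply] at hxc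
    refine (eventually_lt_add (hf x hxG) (hw x hxG) ?_).mono fun y hy => hy.le
    contrapose! hxc
    exact ENNReal.le_sub_of_add_le_left (ne_top_of_le_ne_top (hf_top x hxG)
      (le_self_add.trans hxc)) hxc
  · by_cases hxcl : x ∈ closure G
    · exact hb x (hG.frontier_eq ▸ ⟨hxcl, hxG⟩) c (bot_le.trans_lt hxc)
    · simp [notMem_closure_iff_nhdsWithin_eq_bot.1 hxcl]

theorem exists_one_le_mul {F : Set X} (hF : IsCompact F) {s : X → ENNReal}
    (hs : LowerSemicontinuousOn s F) (hpos : ∀ x ∈ F, 0 < s x) :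
    ∃ c : ENNReal, c ≠ ⊤ ∧ ∀ x ∈ F, 1 ≤ c * s x := by
  rcases F.eq_empty_or_nonempty with rfl | hne
  · exact ⟨0, by simp, by simp⟩
  obtain ⟨a, ha, hmin⟩ := hs.exists_isMinOn hne hF
  have h0 : min (s a) 1 ≠ 0 := (lt_min (hpos a ha) one_pos).ne'
  have htop : min (s a) 1 ≠ ⊤ := ((min_le_right _ _).trans_lt ENNReal.one_lt_top).ne
  exact ⟨(min (s a) 1)⁻¹, ENNReal.inv_ne_top.2 h0, fun x hx =>
    (ENNReal.inv_mul_cancel h0 htop).symm.trans_le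
      (mul_le_mul' le_rfl ((min_le_left _ _).trans (isMinOn_iff.1 hmin x hx)))⟩

theorem aemeasurable_of_lowerSemicontinuousOn [MeasurableSpace X] [BorelSpace X]
    {μ : Measure X} {S : Set X} (hS : MeasurableSet S) (hμ : ∀ᵐ y ∂μ, y ∈ S) {u : X → ENNReal}
    (hu : LowerSemicontinuousOn u S) : AEMeasurable u μ := by
  rw [← Measure.restrict_eq_self_of_ae_mem hμ]
  exact (aemeasurable_restrict_iff_comap_subtype hS).2
    (lowerSemicontinuous_restrict_iff.2 hu).measurable.aemeasurable

theorem measure_sUnion_eq_zero [SecondCountableTopology X] [MeasurableSpace X]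
    {μ : Measure X} {S : Set (Set X)} (hS : ∀ O ∈ S, IsOpen O) (h : ∀ O ∈ S, μ O = 0) :
    μ (⋃₀ S) = 0 :=
  measure_null_of_locally_null _ fun _ ⟨O, hO, hxO⟩ =>
    ⟨O, mem_nhdsWithin_of_mem_nhds ((hS O hO).mem_nhds hxO), h O hO⟩

end SemicontinuousFunctions

section Kernels

theorem ofReal_integral_le_lintegral {α : Type*} [MeasurableSpace α] (μ : Measure α) (f : α → ℝ) :
    ENNReal.ofReal (∫ x, f x ∂μ) ≤ ∫⁻ x, ENNReal.ofReal (f x) ∂μ := by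
  by_cases hf : Integrable f μ
  · rw [integral_eq_lintegral_pos_part_sub_lintegral_neg_part hf]
    exact (ENNReal.ofReal_le_ofReal (sub_le_self _ ENNReal.toReal_nonneg)).trans
      ENNReal.ofReal_toReal_le
  · simp only [integral_undef hf, ENNReal.ofReal_zero, zero_le]

theorem eintegral_of_nonneg {X : Type*} [MeasurableSpace X] {μ : Measure X} {u : X → EReal}
    (h : ∀ᵐ y ∂μ, 0 ≤ u y) :
    eintegral μ u = ((∫⁻ y, (u y).toENNReal ∂μ : ENNReal) : EReal) := by
  have hneg : ∫⁻ x, (-u x).toENNReal ∂μ = 0 := by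
    rw [lintegral_congr_ae (h.mono fun y hy => EReal.toENNReal_of_nonpos (EReal.neg_le_zero.2 hy)),
      lintegral_zero]
  rw [eintegral, hneg, EReal.coe_ennreal_zero, sub_zero]

variable {X : Type*} [TopologicalSpace X] {𝒱 : Set (Set X)}

/-- The members of `𝒱` with closure in `U` which contain `x`: the largest family that can be
tested at `x` when checking hyperharmonicity on `U`. -/
def insideAt (𝒱 : Set (Set X)) (U : Set X) (x : X) : Set (Set X) :=
  {W | W ∈ inside 𝒱 U ∧ x ∈ W}

/-- `𝒢` assigns to each point `x` of `U` a nonempty family of members of `𝒱` containing `x`, with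
closure in `U`. This weakens `IsLocalChoice`: the family need not be a neighborhood basis. -/
def IsSelection (𝒱 : Set (Set X)) (U : Set X) (𝒢 : X → Set (Set X)) : Prop :=
  ∀ x ∈ U, (𝒢 x).Nonempty ∧ 𝒢 x ⊆ insideAt 𝒱 U x

theorem insideAt_mono {U U' : Set X} (h : U' ⊆ U) (x : X) : insideAt 𝒱 U' x ⊆ insideAt 𝒱 U x :=
  fun _ hW => ⟨⟨hW.1.1, hW.1.2.trans h⟩, hW.2⟩

variable [MeasurableSpace X] {H : Set X → Kernel X X}

/-- The `[0, ∞]`-valued form of a positive `𝒲`-hyperharmonic function on `U`, with the Lebesgue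
integral in place of `eintegral`; only the values on `U` matter. -/
def PosHyperharmonicFor (H : Set X → Kernel X X) (𝒲 : X → Set (Set X)) (U : Set X)
    (s : X → ENNReal) : Prop :=
  LowerSemicontinuousOn s U ∧ ∀ x ∈ U, ∀ W ∈ 𝒲 x, ∫⁻ y, s y ∂(H W x) ≤ s x

/-- The positive `𝒲`-hyperharmonic functions on `U`, in their `[0, ∞]`-valued form, separate the
points of `U`. -/
def PosHyperharmonicSeparates (H : Set X → Kernel X X) (𝒲 : X → Set (Set X)) (U : Set X) : Prop :=
  ∀ x ∈ U, ∀ y ∈ U, x ≠ y → ∃ s, PosHyperharmonicFor H 𝒲 U s ∧ s x ≠ s y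

theorem PosHyperharmonicFor.mono {𝒲 𝒲' : X → Set (Set X)} {U U' : Set X} {s : X → ENNReal}
    (h : PosHyperharmonicFor H 𝒲 U s) (hU : U' ⊆ U) (hW : ∀ x ∈ U', 𝒲' x ⊆ 𝒲 x) :
    PosHyperharmonicFor H 𝒲' U' s :=
  ⟨h.1.mono hU, fun x hx W hx' => h.2 x (hU hx) W (hW x hx hx')⟩

theorem PosHyperharmonicFor.const_mul {𝒲 : X → Set (Set X)} {U : Set X} {s : X → ENNReal}
    (h : PosHyperharmonicFor H 𝒲 U s) {c : ENNReal} (hc : c ≠ ⊤) :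
    PosHyperharmonicFor H 𝒲 U fun x => c * s x := by
  refine ⟨(ENNReal.continuous_const_mul hc).comp_lowerSemicontinuousOn h.1 fun _ _ hst =>
    mul_le_mul_right hst c, fun x hx W hW => ?_⟩
  rw [lintegral_const_mul' c s hc]
  exact mul_le_mul_right (h.2 x hx W hW) c

theorem PosHyperharmonicSeparates.mono {𝒲 𝒲' : X → Set (Set X)} {U U' : Set X}
    (h : PosHyperharmonicSeparates H 𝒲 U) (hU : U' ⊆ U) (hW : ∀ x ∈ U', 𝒲' x ⊆ 𝒲 x) :
    PosHyperharmonicSeparates H 𝒲' U' := fun x hx y hy hxy =>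
  let ⟨s, hs, hsxy⟩ := h x (hU hx) y (hU hy) hxy
  ⟨s, hs.mono hU hW, hsxy⟩

namespace IsNormalBauerFamily

theorem isOpen (hH : IsNormalBauerFamily 𝒱 H) {V : Set X} (hV : V ∈ 𝒱) : IsOpen V :=
  hH.isBasis.isOpen hV

theorem isProbabilityMeasure (hH : IsNormalBauerFamily 𝒱 H) {V : Set X} (hV : V ∈ 𝒱) (x : X) :
    IsProbabilityMeasure (H V x) :=
  ⟨hH.H2_normal V hV x⟩

theorem ae_mem_frontier (hH : IsNormalBauerFamily 𝒱 H) {V : Set X} (hV : V ∈ 𝒱) {x : X}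
    (hx : x ∈ V) : ∀ᵐ y ∂(H V x), y ∈ frontier V :=
  (hH.boundary V hV).1 x hx

theorem ae_mem_of_mem_insideAt (hH : IsNormalBauerFamily 𝒱 H) {U W : Set X} {x : X}
    (hW : W ∈ insideAt 𝒱 U x) : ∀ᵐ y ∂(H W x), y ∈ U :=
  (hH.ae_mem_frontier hW.1.1 hW.2).mono fun _ hy => hW.1.2 (frontier_subset_closure hy)

theorem exists_mem_insideAt [RegularSpace X] (hH : IsNormalBauerFamily 𝒱 H)
    {N : Set X} {x : X} (hN : N ∈ 𝓝 x) : (insideAt 𝒱 N x).Nonempty := by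
  obtain ⟨C, hC, hCc, hCN⟩ := exists_mem_nhds_isClosed_subset hN
  obtain ⟨W, hW, hxW, hWC⟩ := hH.isBasis.mem_nhds_iff.1 hC
  exact ⟨W, ⟨hW, (closure_minimal hWC hCc).trans hCN⟩, hxW⟩

theorem isSelection_insideAt [RegularSpace X] (hH : IsNormalBauerFamily 𝒱 H) {U : Set X}
    (hU : IsOpen U) : IsSelection 𝒱 U (insideAt 𝒱 U) :=
  fun _ hx => ⟨hH.exists_mem_insideAt (hU.mem_nhds hx), Subset.rfl⟩

theorem aemeasurable [BorelSpace X] (hH : IsNormalBauerFamily 𝒱 H) {U W : Set X} {x : X}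
    (hW : W ∈ insideAt 𝒱 U x) {u : X → ENNReal} (hu : LowerSemicontinuousOn u U) :
    AEMeasurable u (H W x) :=
  aemeasurable_of_lowerSemicontinuousOn isClosed_frontier.measurableSet
    (hH.ae_mem_frontier hW.1.1 hW.2) (hu.mono (frontier_subset_closure.trans hW.1.2))

theorem posHyperharmonicFor_toENNReal (hH : IsNormalBauerFamily 𝒱 H)
    {𝒲 : X → Set (Set X)} {U : Set X} (h𝒲 : ∀ x ∈ U, 𝒲 x ⊆ insideAt 𝒱 U x) {u : X → EReal}
    (hu : HyperharmonicFor H 𝒲 U u) (h0 : ∀ x ∈ U, 0 ≤ u x) :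
    PosHyperharmonicFor H 𝒲 U fun x => (u x).toENNReal := by
  refine ⟨EReal.continuous_toENNReal.comp_lowerSemicontinuousOn hu.1 fun _ _ h =>
    EReal.toENNReal_le_toENNReal h, fun x hx W hW => ?_⟩
  rw [← EReal.coe_ennreal_le_coe_ennreal_iff, EReal.coe_toENNReal (h0 x hx),
    ← eintegral_of_nonneg ((hH.ae_mem_of_mem_insideAt (h𝒲 x hx hW)).mono h0)]
  exact hu.2.2 x hx W hW

theorem posHyperharmonicSeparates (hH : IsNormalBauerFamily 𝒱 H)
    {𝒲 : X → Set (Set X)} {U : Set X} (h𝒲 : ∀ x ∈ U, 𝒲 x ⊆ insideAt 𝒱 U x)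
    (hU : PosSeparates {u | HyperharmonicFor H 𝒲 U u} U) : PosHyperharmonicSeparates H 𝒲 U := by
  intro x hx y hy hxy
  obtain ⟨u, hu, h0, hne⟩ := hU x hx y hy hxy
  refine ⟨_, hH.posHyperharmonicFor_toENNReal h𝒲 hu h0, fun h => hne ?_⟩
  rw [← EReal.coe_toENNReal (h0 x hx), h, EReal.coe_toENNReal (h0 y hy)]

theorem posHyperharmonicSeparates_of_isPSet (hH : IsNormalBauerFamily 𝒱 H) {U : Set X}
    (hU : IsPSet 𝒱 H U) : PosHyperharmonicSeparates H (insideAt 𝒱 U) U :=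
  hH.posHyperharmonicSeparates (fun _ _ => Subset.rfl) hU.2

theorem lintegral_of_notMem [MeasurableSingletonClass X] (hH : IsNormalBauerFamily 𝒱 H)
    {V : Set X} (hV : V ∈ 𝒱) {x : X} (hx : x ∉ V) (f : X → ENNReal) :
    ∫⁻ y, f y ∂(H V x) = f x := by
  rw [(hH.boundary V hV).2 x hx, lintegral_dirac]

theorem lintegral_ne_top [T1Space X] [BorelSpace X] (hH : IsNormalBauerFamily 𝒱 H) {V : Set X}
    (hV : V ∈ 𝒱) {f : X → ENNReal} (hf : Continuous f) (hf_top : ∀ x, f x ≠ ⊤) (x : X) :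
    ∫⁻ y, f y ∂(H V x) ≠ ⊤ := by
  have := hH.isProbabilityMeasure hV x
  by_cases hx : x ∈ V
  · obtain ⟨C, hC, hfC⟩ : ∃ C, C ≠ ⊤ ∧ ∀ y ∈ frontier V, f y ≤ C := by
      rcases (frontier V).eq_empty_or_nonempty with h | h
      · exact ⟨0, by simp, by simp [h]⟩
      obtain ⟨a, -, ha⟩ := ((hH.isCompact_closure V hV).of_isClosed_subset isClosed_frontier
        frontier_subset_closure).exists_isMaxOn h hf.continuousOn
      exact ⟨f a, hf_top a, isMaxOn_iff.1 ha⟩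
    refine ne_top_of_le_ne_top hC ?_
    calc ∫⁻ y, f y ∂(H V x) ≤ ∫⁻ _, C ∂(H V x) :=
          lintegral_mono_ae ((hH.ae_mem_frontier hV hx).mono hfC)
      _ = C := by simp
  · exact (hH.lintegral_of_notMem hV hx f).trans_ne (hf_top x)

theorem continuous_lintegral [T1Space X] [BorelSpace X] (hH : IsNormalBauerFamily 𝒱 H) {V : Set X}
    (hV : V ∈ 𝒱) {f : X → ENNReal} (hf : Continuous f) (hf_top : ∀ x, f x ≠ ⊤) :
    Continuous fun x => ∫⁻ y, f y ∂(H V x) := by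
  refine (ENNReal.continuous_ofReal.comp (hH.H2_continuous V hV (fun x => (f x).toReal)
    (continuous_iff_continuousAt.2 fun x =>
      (ENNReal.tendsto_toReal (hf_top x)).comp hf.continuousAt))).congr fun x => ?_
  rw [Function.comp_apply, integral_toReal hf.measurable.aemeasurable
    (Eventually.of_forall fun y => (hf_top y).lt_top),
    ENNReal.ofReal_toReal (hH.lintegral_ne_top hV hf hf_top x)]

theorem lowerSemicontinuous_lintegral [T2Space X] [LocallyCompactSpace X]
    [SecondCountableTopology X] [BorelSpace X] (hH : IsNormalBauerFamily 𝒱 H) {V : Set X}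
    (hV : V ∈ 𝒱) {u : X → ENNReal} (hu : LowerSemicontinuous u) :
    LowerSemicontinuous fun x => ∫⁻ y, u y ∂(H V x) := by
  intro x a ha
  obtain ⟨f, hf, hf_top, hfu, haf⟩ := exists_continuous_lt_lintegral hu ha
  filter_upwards [(hH.continuous_lintegral hV hf hf_top).continuousAt.eventually_const_lt haf]
    with y hy using hy.trans_le (lintegral_mono hfu)

theorem lowerSemicontinuous_measure [T2Space X] [LocallyCompactSpace X]
    [SecondCountableTopology X] [BorelSpace X] (hH : IsNormalBauerFamily 𝒱 H) {V O : Set X}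
    (hV : V ∈ 𝒱) (hO : IsOpen O) : LowerSemicontinuous fun x => H V x O := by
  have h1 : LowerSemicontinuous (O.indicator (1 : X → ENNReal)) :=
    hO.lowerSemicontinuous_indicator zero_le
  simpa only [lintegral_indicator_one hO.measurableSet] using
    hH.lowerSemicontinuous_lintegral hV h1

theorem lintegral_lintegral (hH : IsNormalBauerFamily 𝒱 H) {V W : Set X} (hV : V ∈ 𝒱) (hW : W ∈ 𝒱)
    (hWV : W ⊆ V) {f : X → ENNReal} (hf : Measurable f) (x : X) :
    ∫⁻ y, ∫⁻ z, f z ∂(H V y) ∂(H W x) = ∫⁻ z, f z ∂(H V x) := by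
  rw [← Kernel.lintegral_comp _ _ _ hf, hH.H1 V hV W hW hWV]

theorem lintegral_le_one (hH : IsNormalBauerFamily 𝒱 H) {V : Set X} (hV : V ∈ 𝒱) {f : X → ENNReal}
    (hf : ∀ x, f x ≤ 1) (x : X) : ∫⁻ y, f y ∂(H V x) ≤ 1 :=
  (lintegral_mono hf).trans_eq (lintegral_one.trans (hH.H2_normal V hV x))

theorem continuousOn_lintegral (hH : IsNormalBauerFamily 𝒱 H) {V : Set X}
    (hV : V ∈ 𝒱) {f : X → ENNReal} (hf : Measurable f) (hf1 : ∀ x, f x ≤ 1) :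
    ContinuousOn (fun x => ∫⁻ y, f y ∂(H V x)) V := by
  have h := hH.H4 V hV (fun x => (f x).toReal) hf.ennreal_toReal
    ⟨1, fun x => by simpa using ENNReal.toReal_mono ENNReal.one_ne_top (hf1 x)⟩
  refine (ENNReal.continuous_ofReal.comp_continuousOn h).congr fun x _ => ?_
  rw [Function.comp_apply, integral_toReal hf.aemeasurable
    (Eventually.of_forall fun x => (hf1 x).trans_lt ENNReal.one_lt_top), ENNReal.ofReal_toReal]
  exact ne_top_of_le_ne_top ENNReal.one_ne_top (hH.lintegral_le_one hV hf1 x)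

theorem continuousOn_measure (hH : IsNormalBauerFamily 𝒱 H) {V A : Set X} (hV : V ∈ 𝒱)
    (hA : MeasurableSet A) : ContinuousOn (fun x => H V x A) V := by
  simpa only [lintegral_indicator_one hA] using hH.continuousOn_lintegral hV
    (measurable_one.indicator hA) (indicator_le_self A 1)

end IsNormalBauerFamily

end Kernels

section Comparison

variable {X : Type*} [TopologicalSpace X] [MeasurableSpace X] {𝒱 : Set (Set X)}
  {H : Set X → Kernel X X}

/-- `A` is absorbing for the family `𝒢`: the measures `H W x` with `x ∈ A` and `W ∈ 𝒢 x` do not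
charge the complement of `A`. -/
def IsAbsorbing (H : Set X → Kernel X X) (𝒢 : X → Set (Set X)) (A : Set X) : Prop :=
  ∀ x ∈ A, ∀ W ∈ 𝒢 x, ∀ᵐ y ∂(H W x), y ∈ A

theorem IsAbsorbing.sInter [SecondCountableTopology X] {𝒢 : X → Set (Set X)} {c : Set (Set X)}
    (hc : ∀ A ∈ c, IsClosed A) (h : ∀ A ∈ c, IsAbsorbing H 𝒢 A) : IsAbsorbing H 𝒢 (⋂₀ c) := by
  intro x hx W hW
  rw [ae_iff, ← compl_def, compl_sInter]
  refine measure_sUnion_eq_zero ?_ ?_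
  · rintro _ ⟨A, hA, rfl⟩
    exact (hc A hA).isOpen_compl
  · rintro _ ⟨A, hA, rfl⟩
    exact h A hA x (hx A hA) W hW

theorem IsAbsorbing.exists_minimal [SecondCountableTopology X] [T2Space X]
    {𝒢 : X → Set (Set X)} {M : Set X}
    (hM : IsCompact M) (hne : M.Nonempty) (habs : IsAbsorbing H 𝒢 M) :
    ∃ A ⊆ M, Minimal (fun A => IsClosed A ∧ A.Nonempty ∧ IsAbsorbing H 𝒢 A) A := by
  have hlower : ∀ c ⊆ {A | A ⊆ M ∧ IsClosed A ∧ A.Nonempty ∧ IsAbsorbing H 𝒢 A},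
      IsChain (· ⊆ ·) c → c.Nonempty →
        ∃ B ∈ {A | A ⊆ M ∧ IsClosed A ∧ A.Nonempty ∧ IsAbsorbing H 𝒢 A}, ∀ A ∈ c, B ⊆ A := by
    intro c hc hchain hcne
    obtain ⟨A, hA⟩ := hcne
    refine ⟨⋂₀ c, ⟨(sInter_subset_of_mem hA).trans (hc hA).1,
      isClosed_sInter fun B hB => (hc hB).2.1, ?_,
      .sInter (fun B hB => (hc hB).2.1) fun B hB => (hc hB).2.2.2⟩,
      fun _ => sInter_subset_of_mem⟩
    exact IsCompact.nonempty_sInter_of_directed_nonempty_isCompact_isClosed (hS := ⟨⟨A, hA⟩⟩)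
      (fun B hB C hC => (hchain.total hB hC).elim (fun h => ⟨B, hB, Subset.rfl, h⟩)
        fun h => ⟨C, hC, h, Subset.rfl⟩) (fun B hB => (hc hB).2.2.1)
      (fun B hB => hM.of_isClosed_subset (hc hB).2.1 (hc hB).1) fun B hB => (hc hB).2.1
  obtain ⟨A, hAM, hA⟩ := zorn_superset_nonempty _ hlower M ⟨Subset.rfl, hM.isClosed, hne, habs⟩
  exact ⟨A, hAM, hA.1.2, fun B hB hBA => hA.2 ⟨hBA.trans hAM, hB⟩ hBA⟩

namespace IsNormalBauerFamily

variable {G : Set X} {𝒢 : X → Set (Set X)}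

theorem isAbsorbing_minimum [BorelSpace X] (hH : IsNormalBauerFamily 𝒱 H)
    (h𝒢 : ∀ x ∈ G, 𝒢 x ⊆ insideAt 𝒱 G x) {A : Set X} (hAG : A ⊆ G) (hA : IsAbsorbing H 𝒢 A)
    {s : X → ENNReal} (hs : PosHyperharmonicFor H 𝒢 G s) {m : ENNReal} (hm : ∀ x ∈ A, m ≤ s x) :
    IsAbsorbing H 𝒢 (A ∩ s ⁻¹' Iic m) := by
  rintro x ⟨hxA, hxm⟩ W hW
  have hWG := h𝒢 x (hAG hxA) hW
  have := hH.isProbabilityMeasure hWG.1.1 x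
  rcases eq_or_ne m ⊤ with rfl | hm_top
  · simpa using hA x hxA W hW
  have hle : ∀ᵐ y ∂(H W x), m ≤ s y := (hA x hxA W hW).mono hm
  have heq : (fun _ => m) =ᵐ[H W x] s := by
    refine ae_eq_of_ae_le_of_lintegral_le hle (by simpa using hm_top)
      (hH.aemeasurable hWG hs.1) ?_
    simpa using (hs.2 x (hAG hxA) W hW).trans hxm
  filter_upwards [hA x hxA W hW, heq] with y hyA hy using ⟨hyA, hy.ge⟩

theorem not_isAbsorbing_singleton (hH : IsNormalBauerFamily 𝒱 H) (h𝒢 : IsSelection 𝒱 G 𝒢) {a : X}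
    (ha : a ∈ G) : ¬ IsAbsorbing H 𝒢 {a} := by
  intro h
  obtain ⟨W, hW⟩ := (h𝒢 a ha).1
  obtain ⟨⟨hW𝒱, -⟩, haW⟩ := (h𝒢 a ha).2 hW
  have := hH.isProbabilityMeasure hW𝒱 a
  obtain ⟨y, rfl, hy⟩ := ((h a rfl W hW).and (hH.ae_mem_frontier hW𝒱 haW)).exists
  exact ((hH.isOpen hW𝒱).frontier_eq ▸ hy).2 haW

theorem eq_empty_of_isAbsorbing [SecondCountableTopology X] [T2Space X] [BorelSpace X]
    (hH : IsNormalBauerFamily 𝒱 H) (h𝒢 : IsSelection 𝒱 G 𝒢)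
    (hsep : PosHyperharmonicSeparates H 𝒢 G) {M : Set X} (hM : IsCompact M) (hMG : M ⊆ G)
    (habs : IsAbsorbing H 𝒢 M) : M = ∅ := by
  by_contra hne
  obtain ⟨A, hAM, hA⟩ := habs.exists_minimal hM (nonempty_iff_ne_empty.2 hne)
  obtain ⟨hAc, hAne, hAabs⟩ := hA.1
  have hAG := hAM.trans hMG
  have hAcomp := hM.of_isClosed_subset hAc hAM
  -- By minimality, `s` attains its minimum over `A` everywhere on `A`.
  have hconst : ∀ s, PosHyperharmonicFor H 𝒢 G s → ∀ x ∈ A, ∀ y ∈ A, s x ≤ s y := by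
    intro s hs x hx y hy
    obtain ⟨a, ha, hmin⟩ := (hs.1.mono hAG).exists_isMinOn hAne hAcomp
    rw [isMinOn_iff] at hmin
    have hxa : x ∈ A ∩ s ⁻¹' Iic (s a) :=
      hA.2 ⟨((hs.1.mono hAG).isCompact_inter_preimage_Iic hAcomp _).isClosed,
        ⟨a, ha, le_refl (s a)⟩, hH.isAbsorbing_minimum (fun z hz => (h𝒢 z hz).2) hAG hAabs hs hmin⟩
        inter_subset_left hx
    exact hxa.2.trans (hmin y hy)
  obtain ⟨a, ha⟩ := hAne
  have hA_eq : A = {a} := by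
    refine eq_singleton_iff_unique_mem.2 ⟨ha, fun y hy => ?_⟩
    by_contra hya
    obtain ⟨s, hs, hs_ne⟩ := hsep y (hAG hy) a (hAG ha) hya
    exact hs_ne ((hconst s hs y hy a ha).antisymm (hconst s hs a ha y hy))
  exact hH.not_isAbsorbing_singleton h𝒢 (hAG ha) (hA_eq ▸ hAabs)

theorem eq_zero_of_upperSemicontinuous [SecondCountableTopology X] [T2Space X] [BorelSpace X]
    (hH : IsNormalBauerFamily 𝒱 H) (hGc : IsCompact (closure G)) (h𝒢 : IsSelection 𝒱 G 𝒢)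
    (hsep : PosHyperharmonicSeparates H 𝒢 G) {d : X → ENNReal} (hd : UpperSemicontinuous d)
    (hd0 : ∀ x ∉ G, d x = 0) (hd_top : ∀ x, d x ≠ ⊤)
    (hd_sub : ∀ x ∈ G, ∀ W ∈ 𝒢 x, d x ≤ ∫⁻ y, d y ∂(H W x)) (x : X) : d x = 0 := by
  by_contra hx
  have hG_of_ne : ∀ y, d y ≠ 0 → y ∈ G := fun y hy => not_imp_comm.1 (hd0 y) hy
  obtain ⟨z, -, hmax⟩ := (hd.upperSemicontinuousOn (closure G)).exists_isMaxOn
    ⟨x, subset_closure (hG_of_ne x hx)⟩ hGc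
  have hle : ∀ y, d y ≤ d z := fun y => by
    by_cases hy : y ∈ G
    · exact isMaxOn_iff.1 hmax y (subset_closure hy)
    · simp [hd0 y hy]
  have hz : 0 < d z := (pos_iff_ne_zero.2 hx).trans_le (hle x)
  set A := d ⁻¹' Ici (d z)
  have hAG : A ⊆ G := fun y hy => hG_of_ne y (hz.trans_le hy).ne'
  have hA : IsCompact A :=
    hGc.of_isClosed_subset (hd.isClosed_preimage (d z)) (hAG.trans subset_closure)
  have habs : IsAbsorbing H 𝒢 A := by
    intro y hy W hW
    have := hH.isProbabilityMeasure ((h𝒢 y (hAG hy)).2 hW).1.1 y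
    have heq : d =ᵐ[H W y] fun _ => d z := by
      refine ae_eq_of_ae_le_of_lintegral_le (Eventually.of_forall hle)
        (ne_top_of_le_ne_top (hd_top z) ?_) aemeasurable_const ?_
      · simpa using lintegral_mono (μ := H W y) hle
      · simpa using (mem_Ici.1 hy).trans (hd_sub y (hAG hy) W hW)
    exact heq.mono fun _ h => h.ge
  exact eq_empty_iff_forall_notMem.1 (hH.eq_empty_of_isAbsorbing h𝒢 hsep hA hAG habs) z
    (le_refl (d z))

theorem le_of_frontier [SecondCountableTopology X] [T2Space X] [BorelSpace X]
    (hH : IsNormalBauerFamily 𝒱 H) (hG : IsOpen G)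
    (hGc : IsCompact (closure G)) (h𝒢 : IsSelection 𝒱 G 𝒢)
    (hsep : PosHyperharmonicSeparates H 𝒢 G) {w : X → ENNReal} (hw : PosHyperharmonicFor H 𝒢 G w)
    {f : X → ENNReal} (hf : ContinuousOn f G) (hf_top : ∀ x ∈ G, f x ≠ ⊤)
    (hf_sub : ∀ x ∈ G, ∀ W ∈ 𝒢 x, f x ≤ ∫⁻ y, f y ∂(H W x))
    (hb : ∀ z ∈ frontier G, ∀ ε, 0 < ε → ∀ᶠ x in 𝓝[G] z, f x ≤ w x + ε) :
    ∀ x ∈ G, f x ≤ w x := by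
  have hzero := hH.eq_zero_of_upperSemicontinuous hGc h𝒢 hsep
    (upperSemicontinuous_indicator_sub hG hf hf_top hw.1 hb)
    (fun x hx => indicator_of_notMem hx (f - w)) ?_ ?_
  · intro x hx
    simpa [indicator_of_mem hx, tsub_eq_zero_iff_le] using hzero x
  · intro x
    by_cases hx : x ∈ G
    · simpa only [indicator_of_mem hx, Pi.sub_apply] using ENNReal.sub_ne_top (hf_top x hx)
    · simp [indicator_of_notMem hx]
  · intro x hx W hW
    have hWG := (h𝒢 x hx).2 hW
    calc G.indicator (f - w) x = f x - w x := indicator_of_mem hx _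
      _ ≤ ∫⁻ y, f y ∂(H W x) - ∫⁻ y, w y ∂(H W x) :=
          tsub_le_tsub (hf_sub x hx W hW) (hw.2 x hx W hW)
      _ ≤ ∫⁻ y, (f - w) y ∂(H W x) := lintegral_sub_le' _ _ (hH.aemeasurable hWG hw.1)
      _ = ∫⁻ y, G.indicator (f - w) y ∂(H W x) := lintegral_congr_ae
          ((hH.ae_mem_of_mem_insideAt hWG).mono fun y hy => (indicator_of_mem hy _).symm)

theorem lintegral_le [SecondCountableTopology X] [T2Space X] [LocallyCompactSpace X]
    [BorelSpace X] (hH : IsNormalBauerFamily 𝒱 H) {V : Set X} (hV : V ∈ 𝒱)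
    (h𝒢 : IsSelection 𝒱 V 𝒢) (hsep : PosHyperharmonicSeparates H 𝒢 V) {w : X → ENNReal}
    (hw : PosHyperharmonicFor H 𝒢 V w) (hwc : LowerSemicontinuousOn w (closure V)) :
    ∀ x ∈ V, ∫⁻ y, w y ∂(H V x) ≤ w x := by
  classical
  intro x hx
  have hw_eq : ∀ᵐ y ∂(H V x), w y = (closure V).piecewise w ⊤ y :=
    (hH.ae_mem_frontier hV hx).mono fun y hy =>
      (piecewise_eq_of_mem _ _ _ (frontier_subset_closure hy)).symm
  rw [lintegral_congr_ae hw_eq]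
  by_contra! hcon
  obtain ⟨f, hf, hf_top, hfu, hlt⟩ :=
    exists_continuous_lt_lintegral (lowerSemicontinuous_piecewise_top isClosed_closure hwc) hcon
  have hcont := hH.continuous_lintegral hV hf hf_top
  refine hlt.not_ge (hH.le_of_frontier (hH.isOpen hV) (hH.isCompact_closure V hV) h𝒢 hsep hw
    hcont.continuousOn (fun y _ => hH.lintegral_ne_top hV hf hf_top y) (fun y hy W hW => ?_)
    (fun z hz ε hε => ?_) x hx)
  · obtain ⟨⟨hW𝒱, hWV⟩, -⟩ := (h𝒢 y hy).2 hW
    exact (hH.lintegral_lintegral hV hW𝒱 (subset_closure.trans hWV) hf.measurable y).ge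
  · have hzV : z ∉ V := ((hH.isOpen hV).frontier_eq ▸ hz).2
    have hzc := frontier_subset_closure hz
    refine (eventually_lt_add hcont.continuousWithinAt ((hwc z hzc).mono subset_closure) ?_).mono
      fun y hy => hy.le
    rw [hH.lintegral_of_notMem hV hzV]
    have hfz : f z ≤ w z := by simpa only [piecewise_eq_of_mem _ _ _ hzc] using hfu z
    rcases eq_or_ne (w z) ⊤ with h | h
    · simpa [h] using (hf_top z).lt_top
    · exact hfz.trans_lt (ENNReal.lt_add_right h hε.ne')

theorem posHyperharmonicSeparates_of_mem [SecondCountableTopology X] [T2Space X]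
    [LocallyCompactSpace X] [BorelSpace X] (hH : IsNormalBauerFamily 𝒱 H) {V : Set X}
    (hV : V ∈ 𝒱) : PosHyperharmonicSeparates H (insideAt 𝒱 V) V := by
  obtain ⟨𝒲, h𝒲, hsep⟩ := hH.H3 V hV
  replace hsep := hH.posHyperharmonicSeparates (fun x hx => (h𝒲 x hx).1) hsep
  intro x hx y hy hxy
  obtain ⟨s, hs, hne⟩ := hsep x hx y hy hxy
  refine ⟨s, ⟨hs.1, fun z _ W hW => ?_⟩, hne⟩
  have hWV : W ⊆ V := subset_closure.trans hW.1.2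
  have h𝒢 : IsSelection 𝒱 W fun y => {W' | W' ∈ 𝒲 y ∧ closure W' ⊆ W} := fun y hy => by
    obtain ⟨C, hC, hCc, hCW⟩ := exists_mem_nhds_isClosed_subset ((hH.isOpen hW.1.1).mem_nhds hy)
    obtain ⟨W', hW', hWC⟩ := (h𝒲 y (hWV hy)).2 C hC
    refine ⟨⟨W', hW', (closure_minimal hWC hCc).trans hCW⟩, fun W'' hW'' => ?_⟩
    obtain ⟨hin, hyW''⟩ := (h𝒲 y (hWV hy)).1 W'' hW''.1
    exact ⟨⟨hin.1, hW''.2⟩, hyW''⟩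
  exact hH.lintegral_le hW.1.1 h𝒢 (hsep.mono hWV fun _ _ _ h => h.1)
    (hs.mono hWV fun _ _ _ h => h.1) (hs.1.mono hW.1.2) z hW.2

theorem posHyperharmonicFor_of_local [SecondCountableTopology X] [T2Space X]
    [LocallyCompactSpace X] [BorelSpace X] (hH : IsNormalBauerFamily 𝒱 H) {U : Set X}
    {w : X → ENNReal} (hw : LowerSemicontinuousOn w U)
    (hloc : ∀ x ∈ U, ∀ N ∈ 𝓝 x, ∃ W ∈ insideAt 𝒱 N x, ∫⁻ y, w y ∂(H W x) ≤ w x) :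
    PosHyperharmonicFor H (insideAt 𝒱 U) U w := by
  refine ⟨hw, fun x _ V hV => ?_⟩
  have hVU : V ⊆ U := subset_closure.trans hV.1.2
  have h𝒢 : IsSelection 𝒱 V fun y => {W | W ∈ insideAt 𝒱 V y ∧ ∫⁻ z, w z ∂(H W y) ≤ w y} :=
    fun y hy => ⟨hloc y (hVU hy) V ((hH.isOpen hV.1.1).mem_nhds hy), fun _ h => h.1⟩
  exact hH.lintegral_le hV.1.1 h𝒢
    ((hH.posHyperharmonicSeparates_of_mem hV.1.1).mono Subset.rfl fun _ _ _ h => h.1)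
    ⟨hw.mono hVU, fun _ _ _ h => h.2⟩ (hw.mono hV.1.2) x hV.2

end IsNormalBauerFamily

end Comparison

section Connectedness

variable {X : Type*} [TopologicalSpace X]

theorem subset_of_disjoint_frontier {S A : Set X} (hS : IsPreconnected S) (hA : IsOpen A)
    (hSA : (S ∩ A).Nonempty) (hdisj : Disjoint S (frontier A)) : S ⊆ A :=
  hS.subset_of_closure_inter_subset hA hSA fun _ hx =>
    by_contra fun hxA => hdisj.notMem_of_mem_left hx.2 (hA.frontier_eq ▸ ⟨hx.1, hxA⟩)

theorem disjoint_frontier_connectedComponentIn [LocallyConnectedSpace X] {U : Set X}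
    (hU : IsOpen U) (x : X) : Disjoint (frontier (connectedComponentIn U x)) U := by
  refine Set.disjoint_left.2 fun z hz hzU => ?_
  have hxU : x ∈ U := connectedComponentIn_nonempty_iff.1 (closure_nonempty_iff.1 ⟨z, hz.1⟩)
  rw [hU.connectedComponentIn.frontier_eq] at hz
  have hpre : IsPreconnected (insert z (connectedComponentIn U x)) :=
    isPreconnected_connectedComponentIn.subset_closure (subset_insert _ _)
      (insert_subset hz.1 subset_closure)
  exact hz.2 (hpre.subset_connectedComponentIn
    (mem_insert_of_mem _ (mem_connectedComponentIn hxU))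
    (insert_subset hzU (connectedComponentIn_subset _ _)) (mem_insert _ _))

theorem inter_frontier_connectedComponentIn_nonempty [LocallyConnectedSpace X] {D W : Set X}
    {a x : X} (hD : IsPreconnected D) (haD : a ∈ D) (hxD : x ∈ closure D) (hW : IsOpen W)
    (hxW : x ∈ W) (haW : a ∉ W) : (D ∩ frontier (connectedComponentIn W x)).Nonempty := by
  have hC : IsOpen (connectedComponentIn W x) := hW.connectedComponentIn
  have hDC : (D ∩ connectedComponentIn W x).Nonempty :=
    inter_comm D _ ▸ mem_closure_iff.1 hxD _ hC (mem_connectedComponentIn hxW)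
  refine Set.not_disjoint_iff_nonempty_inter.1 fun hdisj => haW ?_
  exact connectedComponentIn_subset _ _ (subset_of_disjoint_frontier hD hC hDC hdisj haD)

theorem isPreconnected_sdiff_sUnion {V : Set X} (hV : IsOpen V) {x : X}
    (hQ : IsOpen (V \ ⋃₀ {A | IsOpen A ∧ IsOpen (V \ A) ∧ x ∉ A})) (hxV : x ∈ V) :
    IsPreconnected (V \ ⋃₀ {A | IsOpen A ∧ IsOpen (V \ A) ∧ x ∉ A}) := by
  set O := ⋃₀ {A | IsOpen A ∧ IsOpen (V \ A) ∧ x ∉ A}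
  have hO : IsOpen O := isOpen_sUnion fun A hA => hA.1
  have hxQ : x ∈ V \ O := ⟨hxV, fun ⟨A, hA, hxA⟩ => hA.2.2 hxA⟩
  have key : ∀ u v : Set X, IsOpen u → IsOpen v → V \ O ⊆ u ∪ v → V \ O ∩ (u ∩ v) = ∅ → x ∈ u →
      V \ O ⊆ u := by
    intro u v hu hv huv hdisj hxu
    have hcompl : V \ ((V \ O) ∩ v) = (V ∩ O) ∪ ((V \ O) ∩ u) := by
      ext y
      have := @huv y
      have := eq_empty_iff_forall_notMem.1 hdisj y
      grind
    have hsub : (V \ O) ∩ v ⊆ O := subset_sUnion_of_mem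
      ⟨hQ.inter hv, hcompl ▸ (hV.inter hO).union (hQ.inter hu),
        fun hxv => eq_empty_iff_forall_notMem.1 hdisj x ⟨hxQ, hxu, hxv.2⟩⟩
    exact fun y hy => (huv hy).resolve_right fun hyv => hy.2 (hsub ⟨hy, hyv⟩)
  refine isPreconnected_iff_subset_of_disjoint.2 fun u v hu hv huv hdisj => ?_
  rcases huv hxQ with hxu | hxv
  · exact Or.inl (key u v hu hv huv hdisj hxu)
  · exact Or.inr (key v u hv hu (union_comm u v ▸ huv) (inter_comm u v ▸ hdisj) hxv)

end Connectedness

section LocalConnectedness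

variable {X : Type*} [TopologicalSpace X] [T2Space X] [LocallyCompactSpace X]
  [SecondCountableTopology X] [MeasurableSpace X] [BorelSpace X]
  {𝒱 : Set (Set X)} {H : Set X → Kernel X X}

namespace IsNormalBauerFamily

theorem posHyperharmonicFor_indicator (hH : IsNormalBauerFamily 𝒱 H) {U O : Set X}
    (hO : IsOpen O) (hUO : IsOpen (U \ O)) :
    PosHyperharmonicFor H (insideAt 𝒱 U) U (O.indicator 1) := by
  refine hH.posHyperharmonicFor_of_local
    ((hO.lowerSemicontinuous_indicator zero_le).lowerSemicontinuousOn U) fun x hx N hN => ?_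
  simp_rw [lintegral_indicator_one hO.measurableSet]
  by_cases hxO : x ∈ O
  · obtain ⟨W, hW⟩ := hH.exists_mem_insideAt hN
    have := hH.isProbabilityMeasure hW.1.1 x
    exact ⟨W, hW, by simpa only [indicator_of_mem hxO, Pi.one_apply] using prob_le_one⟩
  · obtain ⟨W, hW⟩ := hH.exists_mem_insideAt (inter_mem hN (hUO.mem_nhds ⟨hx, hxO⟩))
    have hzero : H W x O = 0 := measure_eq_zero_iff_ae_notMem.2
      ((hH.ae_mem_of_mem_insideAt hW).mono fun y hy => hy.2.2)
    exact ⟨W, insideAt_mono inter_subset_left x hW, hzero.trans_le zero_le⟩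

theorem measure_eq_zero_of_isOpen_sdiff (hH : IsNormalBauerFamily 𝒱 H) {U O W : Set X}
    (hO : IsOpen O) (hUO : IsOpen (U \ O)) {x : X} (hx : x ∉ O) (hW : W ∈ insideAt 𝒱 U x) :
    H W x O = 0 := by
  have h := (hH.posHyperharmonicFor_indicator hO hUO).2 x (hW.1.2 (subset_closure hW.2)) W hW
  rwa [lintegral_indicator_one hO.measurableSet, indicator_of_notMem hx, nonpos_iff_eq_zero] at h

theorem isOpen_sdiff_sUnion (hH : IsNormalBauerFamily 𝒱 H) {V : Set X} (hV : IsOpen V)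
    {𝒮 : Set (Set X)} (h𝒮 : ∀ A ∈ 𝒮, IsOpen A ∧ IsOpen (V \ A)) : IsOpen (V \ ⋃₀ 𝒮) := by
  have hO : IsOpen (⋃₀ 𝒮) := isOpen_sUnion fun A hA => (h𝒮 A hA).1
  refine isOpen_iff_mem_nhds.2 fun y hy => ?_
  obtain ⟨W, hW⟩ := hH.exists_mem_insideAt (hV.mem_nhds hy.1)
  have hWo := hH.isOpen hW.1.1
  have hy0 : H W y (⋃₀ 𝒮) = 0 := measure_sUnion_eq_zero (fun A hA => (h𝒮 A hA).1) fun A hA =>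
    hH.measure_eq_zero_of_isOpen_sdiff (h𝒮 A hA).1 (h𝒮 A hA).2 (fun hyA => hy.2 ⟨A, hA, hyA⟩) hW
  have hlt : ∀ᶠ z in 𝓝 y, H W z (⋃₀ 𝒮) < 1 :=
    ((hH.continuousOn_measure hW.1.1 hO.measurableSet).continuousAt
      (hWo.mem_nhds hW.2)).eventually_lt_const (hy0.trans_lt one_pos)
  filter_upwards [hlt, hWo.mem_nhds hW.2] with z hz hzW
  refine ⟨hW.1.2 (subset_closure hzW), fun ⟨A, hA, hzA⟩ => hz.ne ?_⟩
  have := hH.isProbabilityMeasure hW.1.1 z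
  have hcompl : H W z (V \ A) = 0 := hH.measure_eq_zero_of_isOpen_sdiff (h𝒮 A hA).2
    (Set.sdiff_sdiff_right_self V A ▸ hV.inter (h𝒮 A hA).1) (fun h => h.2 hzA) ⟨hW.1, hzW⟩
  refine (prob_compl_eq_zero_iff hO.measurableSet).1 (show ∀ᵐ t ∂(H W z), t ∈ ⋃₀ 𝒮 from ?_)
  filter_upwards [hH.ae_mem_of_mem_insideAt ⟨hW.1, hzW⟩, measure_eq_zero_iff_ae_notMem.1 hcompl]
    with t htV ht using ⟨A, hA, by_contra fun htA => ht ⟨htV, htA⟩⟩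

theorem locallyConnectedSpace (hH : IsNormalBauerFamily 𝒱 H) : LocallyConnectedSpace X := by
  refine locallyConnectedSpace_iff_subsets_isOpen_isConnected.2 fun x N hN => ?_
  obtain ⟨V, hV, hxV, hVN⟩ := hH.isBasis.mem_nhds_iff.1 hN
  have hVo := hH.isOpen hV
  have hQ : IsOpen (V \ ⋃₀ {A | IsOpen A ∧ IsOpen (V \ A) ∧ x ∉ A}) :=
    hH.isOpen_sdiff_sUnion hVo fun A hA => ⟨hA.1, hA.2.1⟩
  have hxQ : x ∈ V \ ⋃₀ {A | IsOpen A ∧ IsOpen (V \ A) ∧ x ∉ A} :=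
    ⟨hxV, fun ⟨A, hA, hxA⟩ => hA.2.2 hxA⟩
  exact ⟨_, sdiff_subset.trans hVN, hQ, hxQ, ⟨x, hxQ⟩, isPreconnected_sdiff_sUnion hVo hQ hxV⟩

end IsNormalBauerFamily

end LocalConnectedness

section Ellipticity

variable {X : Type*} [TopologicalSpace X] [T2Space X] [LocallyCompactSpace X]
  [SecondCountableTopology X] [MeasurableSpace X] [BorelSpace X]
  {𝒱 : Set (Set X)} {H : Set X → Kernel X X}

namespace IsNormalBauerFamily

theorem harmonic_toReal (hH : IsNormalBauerFamily 𝒱 H) {U : Set X} (hU : IsOpen U)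
    {v : X → ENNReal} (hv : Measurable v) (hv1 : ∀ x, v x ≤ 1)
    (h : ∀ x ∈ U, ∀ W ∈ insideAt 𝒱 U x, ∫⁻ y, v y ∂(H W x) = v x) :
    Harmonic 𝒱 H U fun x => (v x).toReal := by
  have hv_top : ∀ x, v x ≠ ⊤ := fun x => ne_top_of_le_ne_top ENNReal.one_ne_top (hv1 x)
  refine ⟨ENNReal.continuousOn_toReal.comp (f := v) (fun x hx => ?_) fun x _ => hv_top x,
    fun V hV x hx => ?_⟩
  · obtain ⟨W, hW⟩ := hH.exists_mem_insideAt (hU.mem_nhds hx)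
    have hcont : ContinuousOn v W := (hH.continuousOn_lintegral hW.1.1 hv hv1).congr fun y hy =>
      (h y (hW.1.2 (subset_closure hy)) W ⟨hW.1, hy⟩).symm
    exact (hcont.continuousAt ((hH.isOpen hW.1.1).mem_nhds hW.2)).continuousWithinAt
  · rw [integral_toReal hv.aemeasurable (Eventually.of_forall fun y => (hv_top y).lt_top)]
    by_cases hxV : x ∈ V
    · rw [h x hx V ⟨hV, hxV⟩]
    · rw [hH.lintegral_of_notMem hV.1 hxV]

theorem harmonic_measureReal (hH : IsNormalBauerFamily 𝒱 H) {U V A : Set X} (hV : V ∈ 𝒱)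
    (hU : IsOpen U) (hUV : U ⊆ V) (hA : MeasurableSet A) :
    Harmonic 𝒱 H U fun x => (H V x).real A := by
  refine hH.harmonic_toReal hU (Kernel.measurable_coe _ hA) (fun x => ?_) fun x _ W hW => ?_
  · have := hH.isProbabilityMeasure hV x
    exact prob_le_one
  · simpa only [lintegral_indicator_one hA] using hH.lintegral_lintegral hV hW.1.1
      (subset_closure.trans (hW.1.2.trans hUV)) ((measurable_one (α := ENNReal)).indicator hA) x

theorem measure_pos (hH : IsNormalBauerFamily 𝒱 H) (hell : IsElliptic 𝒱 H) {V O : Set X}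
    (hV : V ∈ 𝒱) {x : X} (hx : x ∈ V) (hO : IsOpen O)
    (hne : (O ∩ frontier (connectedComponentIn V x)).Nonempty) : 0 < H V x O := by
  have := hH.locallyConnectedSpace
  obtain ⟨z, hzO, hzC⟩ := hne
  have hzV : z ∉ V :=
    (disjoint_frontier_connectedComponentIn (hH.isOpen hV) x).notMem_of_mem_left hzC
  have hz : H V z O = 1 := by
    rw [(hH.boundary V hV).2 z hzV, Measure.dirac_apply_of_mem hzO]
  obtain ⟨y, hyC, hy⟩ : ∃ y ∈ connectedComponentIn V x, 0 < H V y O :=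
    ((mem_closure_iff_frequently.1 (frontier_subset_closure hzC)).and_eventually
      (hH.lowerSemicontinuous_measure hV hO z 0 (one_pos.trans_eq hz.symm))).exists
  have hxC := mem_connectedComponentIn hx
  rcases hell _ (hH.isOpen hV).connectedComponentIn
    ⟨⟨x, hxC⟩, isPreconnected_connectedComponentIn⟩ _
    (hH.harmonic_measureReal hV (hH.isOpen hV).connectedComponentIn
      (connectedComponentIn_subset _ _) hO.measurableSet)
    (fun _ _ => measureReal_nonneg) with h | h
  · have := hH.isProbabilityMeasure hV y
    exact absurd ((measureReal_eq_zero_iff).1 (h y hyC)) hy.ne'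
  · exact (ENNReal.toReal_pos_iff.1 (h x hxC)).1

theorem eq_zero_or_pos (hH : IsNormalBauerFamily 𝒱 H) (hell : IsElliptic 𝒱 H) {U : Set X}
    (hU : IsOpen U) (hUc : IsPreconnected U) {v : X → ENNReal}
    (hv : PosHyperharmonicFor H (insideAt 𝒱 U) U v) :
    (∀ x ∈ U, v x = 0) ∨ ∀ x ∈ U, 0 < v x := by
  have := hH.locallyConnectedSpace
  by_contra! hcon
  obtain ⟨⟨a, haU, ha⟩, b, hbU, hb⟩ := hcon
  have hG : IsOpen (U ∩ v ⁻¹' Ioi 0) := isOpen_iff_mem_nhds.2 fun y hy =>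
    inter_mem (hU.mem_nhds hy.1) (lowerSemicontinuousAt_of_isOpen hv.1 hU hy.1 0 hy.2)
  have haG : a ∈ U ∩ v ⁻¹' Ioi 0 := ⟨haU, pos_iff_ne_zero.2 ha⟩
  set D := connectedComponentIn (U ∩ v ⁻¹' Ioi 0) a
  have hDG : D ⊆ U ∩ v ⁻¹' Ioi 0 := connectedComponentIn_subset _ _
  have haD : a ∈ D := mem_connectedComponentIn haG
  obtain ⟨x, hxU, hxD⟩ : (U ∩ frontier D).Nonempty := by
    refine Set.not_disjoint_iff_nonempty_inter.1 fun hdisj => ?_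
    exact (hDG (subset_of_disjoint_frontier hUc hG.connectedComponentIn ⟨a, haU, haD⟩ hdisj
      hbU)).2.not_ge hb
  have hxG := (disjoint_frontier_connectedComponentIn hG a).notMem_of_mem_left hxD
  obtain ⟨W, hW⟩ := hH.exists_mem_insideAt
    (inter_mem (hU.mem_nhds hxU) (compl_singleton_mem_nhds fun h => hxG (h ▸ haG)))
  have hDC := inter_frontier_connectedComponentIn_nonempty isPreconnected_connectedComponentIn haD
    (frontier_subset_closure hxD) (hH.isOpen hW.1.1) hW.2
    fun h => (hW.1.2 (subset_closure h)).2 rfl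
  refine (hH.measure_pos hell hW.1.1 hW.2 hG.connectedComponentIn hDC).ne' ?_
  have hWU := insideAt_mono (𝒱 := 𝒱) inter_subset_left x hW
  have hvx : v x = 0 := not_not.1 fun h => hxG ⟨hxU, pos_iff_ne_zero.2 h⟩
  have hint : ∫⁻ y, v y ∂(H W x) = 0 := le_bot_iff.1 ((hv.2 x hxU W hWU).trans_eq hvx)
  rw [lintegral_eq_zero_iff' (hH.aemeasurable hWU hv.1)] at hint
  exact measure_eq_zero_iff_ae_notMem.2 (hint.mono fun y hy hyD => (hDG hyD).2.ne' hy)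

end IsNormalBauerFamily

end Ellipticity

section Balayage

/-- The approximations of the balayage: starting from the indicator of `B`, repeatedly take the
supremum of the function and of all its averages over sets of `𝒱` inside `U`. -/
noncomputable def balayageSeq {X : Type*} [TopologicalSpace X] [MeasurableSpace X]
    (𝒱 : Set (Set X)) (H : Set X → Kernel X X) (U B : Set X) : ℕ → X → ENNReal
  | 0 => B.indicator 1
  | n + 1 => fun x => balayageSeq 𝒱 H U B n x ⊔
      ⨆ V ∈ inside 𝒱 U, ∫⁻ y, balayageSeq 𝒱 H U B n y ∂(H V x)

/-- The balayage (reduced function) of `1` on the open set `B`: the smallest positive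
hyperharmonic function on `U` which is at least `1` on `B`. -/
noncomputable def balayage {X : Type*} [TopologicalSpace X] [MeasurableSpace X]
    (𝒱 : Set (Set X)) (H : Set X → Kernel X X) (U B : Set X) (x : X) : ENNReal :=
  ⨆ n, balayageSeq 𝒱 H U B n x

namespace IsNormalBauerFamily

variable {X : Type*} [TopologicalSpace X] [MeasurableSpace X] {𝒱 : Set (Set X)}
  {H : Set X → Kernel X X} {U B : Set X}

theorem balayageSeq_le_one (hH : IsNormalBauerFamily 𝒱 H) (n : ℕ) (x : X) :
    balayageSeq 𝒱 H U B n x ≤ 1 := by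
  induction n generalizing x with
  | zero => exact indicator_le_self B 1 x
  | succ n ih => exact sup_le (ih x) (iSup₂_le fun V hV => hH.lintegral_le_one hV.1 ih x)

theorem balayage_le_one (hH : IsNormalBauerFamily 𝒱 H) (x : X) : balayage 𝒱 H U B x ≤ 1 :=
  iSup_le fun n => hH.balayageSeq_le_one n x

theorem balayage_ne_top (hH : IsNormalBauerFamily 𝒱 H) (x : X) : balayage 𝒱 H U B x ≠ ⊤ :=
  ne_top_of_le_ne_top ENNReal.one_ne_top (hH.balayage_le_one x)

theorem balayage_eq_one (hH : IsNormalBauerFamily 𝒱 H) {x : X} (hx : x ∈ B) :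
    balayage 𝒱 H U B x = 1 :=
  (hH.balayage_le_one x).antisymm
    (le_iSup_of_le 0 (indicator_of_mem hx (1 : X → ENNReal)).ge)

theorem balayage_le [MeasurableSingletonClass X] (hH : IsNormalBauerFamily 𝒱 H) {w : X → ENNReal}
    (hw : PosHyperharmonicFor H (insideAt 𝒱 U) U w) (hwB : ∀ x ∈ B, 1 ≤ w x) :
    ∀ x ∈ U, balayage 𝒱 H U B x ≤ w x := by
  suffices h : ∀ n, ∀ x ∈ U, balayageSeq 𝒱 H U B n x ≤ w x from
    fun x hx => iSup_le fun n => h n x hx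
  intro n
  induction n with
  | zero => exact fun x _ => indicator_le hwB x
  | succ n ih =>
    refine fun x hx => sup_le (ih x hx) (iSup₂_le fun V hV => ?_)
    by_cases hxV : x ∈ V
    · exact (lintegral_mono_ae ((hH.ae_mem_of_mem_insideAt ⟨hV, hxV⟩).mono ih)).trans
        (hw.2 x hx V ⟨hV, hxV⟩)
    · exact (hH.lintegral_of_notMem hV.1 hxV _).trans_le (ih x hx)

variable [T2Space X] [LocallyCompactSpace X] [SecondCountableTopology X] [BorelSpace X]

theorem lowerSemicontinuous_balayageSeq (hH : IsNormalBauerFamily 𝒱 H) (hB : IsOpen B) (n : ℕ) :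
    LowerSemicontinuous (balayageSeq 𝒱 H U B n) := by
  induction n with
  | zero => exact hB.lowerSemicontinuous_indicator zero_le
  | succ n ih =>
    exact ih.sup (lowerSemicontinuous_biSup fun V hV => hH.lowerSemicontinuous_lintegral hV.1 ih)

theorem lowerSemicontinuous_balayage (hH : IsNormalBauerFamily 𝒱 H) (hB : IsOpen B) :
    LowerSemicontinuous (balayage 𝒱 H U B) :=
  lowerSemicontinuous_iSup fun n => hH.lowerSemicontinuous_balayageSeq hB n

theorem posHyperharmonicFor_balayage (hH : IsNormalBauerFamily 𝒱 H) (hB : IsOpen B) :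
    PosHyperharmonicFor H (insideAt 𝒱 U) U (balayage 𝒱 H U B) := by
  refine ⟨(hH.lowerSemicontinuous_balayage hB).lowerSemicontinuousOn U, fun x _ V hV => ?_⟩
  calc ∫⁻ y, balayage 𝒱 H U B y ∂(H V x)
      = ⨆ n, ∫⁻ y, balayageSeq 𝒱 H U B n y ∂(H V x) :=
        lintegral_iSup (fun n => (hH.lowerSemicontinuous_balayageSeq hB n).measurable)
          (monotone_nat_of_le_succ fun n x => le_sup_left)
    _ ≤ balayage 𝒱 H U B x := iSup_le fun n => le_iSup_of_le (n + 1) <| le_sup_of_le_right <|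
        le_iSup₂ (f := fun V (_ : V ∈ inside 𝒱 U) => ∫⁻ y, balayageSeq 𝒱 H U B n y ∂(H V x)) V hV.1

theorem posHyperharmonicFor_lintegral (hH : IsNormalBauerFamily 𝒱 H) (hU : IsOpen U)
    {v : X → ENNReal} (hv : LowerSemicontinuous v)
    (hvU : PosHyperharmonicFor H (insideAt 𝒱 U) U v) {W : Set X} (hW : W ∈ inside 𝒱 U) :
    PosHyperharmonicFor H (insideAt 𝒱 U) U fun x => ∫⁻ y, v y ∂(H W x) := by
  refine hH.posHyperharmonicFor_of_local
    ((hH.lowerSemicontinuous_lintegral hW.1 hv).lowerSemicontinuousOn U) fun x hx N hN => ?_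
  by_cases hxW : x ∈ W
  · obtain ⟨W', hW'⟩ := hH.exists_mem_insideAt (inter_mem hN ((hH.isOpen hW.1).mem_nhds hxW))
    exact ⟨W', insideAt_mono inter_subset_left x hW', (hH.lintegral_lintegral hW.1 hW'.1.1
      (subset_closure.trans (hW'.1.2.trans inter_subset_right)) hv.measurable x).le⟩
  · obtain ⟨W', hW'⟩ := hH.exists_mem_insideAt (inter_mem hN (hU.mem_nhds hx))
    refine ⟨W', insideAt_mono inter_subset_left x hW', ?_⟩
    rw [hH.lintegral_of_notMem hW.1 hxW]
    have hle : ∀ y ∈ U, ∫⁻ t, v t ∂(H W y) ≤ v y := fun y hy => by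
      by_cases hyW : y ∈ W
      · exact hvU.2 y hy W ⟨hW, hyW⟩
      · exact (hH.lintegral_of_notMem hW.1 hyW v).le
    exact (lintegral_mono_ae ((hH.ae_mem_of_mem_insideAt hW').mono fun y hy => hle y hy.2)).trans
      (hvU.2 x hx W' (insideAt_mono inter_subset_right x hW'))

theorem lintegral_balayage (hH : IsNormalBauerFamily 𝒱 H) (hU : IsOpen U) (hB : IsOpen B)
    {x : X} {W : Set X} (hW : W ∈ insideAt 𝒱 (U \ closure B) x) :
    ∫⁻ y, balayage 𝒱 H U B y ∂(H W x) = balayage 𝒱 H U B x := by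
  have hWU := insideAt_mono (𝒱 := 𝒱) sdiff_subset x hW
  have hxU : x ∈ U := hWU.1.2 (subset_closure hWU.2)
  have hv := hH.posHyperharmonicFor_balayage (U := U) hB
  refine (hv.2 x hxU W hWU).antisymm (hH.balayage_le (hH.posHyperharmonicFor_lintegral hU
    (hH.lowerSemicontinuous_balayage hB) hv hWU.1) (fun y hy => ?_) x hxU)
  have hyW : y ∉ W := fun h => (hW.1.2 (subset_closure h)).2 (subset_closure hy)
  rw [hH.lintegral_of_notMem hW.1.1 hyW, hH.balayage_eq_one hy]

theorem harmonic_balayage (hH : IsNormalBauerFamily 𝒱 H) (hU : IsOpen U) (hB : IsOpen B)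
    {G : Set X} (hG : IsOpen G) (hGU : G ⊆ U \ closure B) :
    Harmonic 𝒱 H G fun x => (balayage 𝒱 H U B x).toReal :=
  hH.harmonic_toReal hG (hH.lowerSemicontinuous_balayage hB).measurable hH.balayage_le_one
    fun x _ _ hW => hH.lintegral_balayage hU hB (insideAt_mono hGU x hW)

theorem balayage_pos (hH : IsNormalBauerFamily 𝒱 H) (hell : IsElliptic 𝒱 H) (hB : IsOpen B)
    {G : Set X} (hG : IsOpen G) (hGc : IsPreconnected G) (hGU : G ⊆ U) (hGB : (G ∩ B).Nonempty) :
    ∀ x ∈ G, 0 < balayage 𝒱 H U B x := by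
  obtain ⟨y, hyG, hyB⟩ := hGB
  refine (hH.eq_zero_or_pos hell hG hGc ((hH.posHyperharmonicFor_balayage hB).mono hGU
    fun _ _ => insideAt_mono hGU _)).resolve_left fun h => ?_
  exact one_ne_zero ((hH.balayage_eq_one hyB).symm.trans (h y hyG))

end IsNormalBauerFamily

end Balayage

section Barrier

namespace IsNormalBauerFamily

variable {X : Type*} [TopologicalSpace X] [MeasurableSpace X] {𝒱 : Set (Set X)}
  {H : Set X → Kernel X X} {U V : Set X} {p q : X → ENNReal}

theorem posHyperharmonicFor_one (hH : IsNormalBauerFamily 𝒱 H) (U : Set X) :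
    PosHyperharmonicFor H (insideAt 𝒱 U) U 1 :=
  ⟨continuous_one.lowerSemicontinuous.lowerSemicontinuousOn U, fun x _ _ hW =>
    hH.lintegral_le_one hW.1.1 (fun _ => le_rfl) x⟩

variable [BorelSpace X]

theorem posHyperharmonicFor_add (hH : IsNormalBauerFamily 𝒱 H)
    (hp : PosHyperharmonicFor H (insideAt 𝒱 U) U p)
    (hq : PosHyperharmonicFor H (insideAt 𝒱 U) U q) :
    PosHyperharmonicFor H (insideAt 𝒱 U) U (p + q) := by
  refine ⟨hp.1.add hq.1, fun x hx W hW => ?_⟩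
  calc ∫⁻ y, (p + q) y ∂(H W x) = ∫⁻ y, p y ∂(H W x) + ∫⁻ y, q y ∂(H W x) :=
        lintegral_add_left' (hH.aemeasurable hW hp.1) q
    _ ≤ p x + q x := add_le_add (hp.2 x hx W hW) (hq.2 x hx W hW)

variable [T2Space X] [LocallyCompactSpace X] [SecondCountableTopology X]

theorem posHyperharmonicFor_measure (hH : IsNormalBauerFamily 𝒱 H) (hV : V ∈ 𝒱) (hUV : U ⊆ V)
    {O : Set X} (hO : IsOpen O) : PosHyperharmonicFor H (insideAt 𝒱 U) U fun x => H V x O := by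
  refine ⟨(hH.lowerSemicontinuous_measure hV hO).lowerSemicontinuousOn U, fun x _ W hW => ?_⟩
  simpa only [lintegral_indicator_one hO.measurableSet] using (hH.lintegral_lintegral hV hW.1.1
    (subset_closure.trans (hW.1.2.trans hUV))
    ((measurable_one (α := ENNReal)).indicator hO.measurableSet) x).le

theorem posHyperharmonicFor_piecewise (hH : IsNormalBauerFamily 𝒱 H) [∀ x, Decidable (x ∈ V)]
    (hU : IsOpen U) (hV : IsOpen V) (hq : PosHyperharmonicFor H (insideAt 𝒱 U) U q)
    (hp : PosHyperharmonicFor H (insideAt 𝒱 (U ∩ V)) (U ∩ V) p)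
    (hpq : ∀ z ∈ U ∩ frontier V, ∀ a < q z, ∀ᶠ y in 𝓝[V] z, a < p y) :
    PosHyperharmonicFor H (insideAt 𝒱 U) U (V.piecewise (q ⊓ p) q) := by
  have hle_q : ∀ y, V.piecewise (q ⊓ p) q y ≤ q y :=
    piecewise_le (fun _ _ => inf_le_left) fun _ _ => le_rfl
  have hle_p : ∀ y ∈ V, V.piecewise (q ⊓ p) q y ≤ p y := fun y hy =>
    (piecewise_eq_of_mem V (q ⊓ p) q hy).trans_le inf_le_right
  refine hH.posHyperharmonicFor_of_local
    (lowerSemicontinuousOn_piecewise_inf hU hV hq.1 hp.1 hpq) fun x hx N hN => ?_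
  by_cases hxV : x ∈ V
  · obtain ⟨W, hW⟩ := hH.exists_mem_insideAt (inter_mem hN ((hU.inter hV).mem_nhds ⟨hx, hxV⟩))
    have hWUV := insideAt_mono (𝒱 := 𝒱) inter_subset_right x hW
    refine ⟨W, insideAt_mono inter_subset_left x hW, ?_⟩
    rw [piecewise_eq_of_mem _ _ _ hxV]
    exact le_inf ((lintegral_mono hle_q).trans
        (hq.2 x hx W (insideAt_mono inter_subset_left x hWUV)))
      ((lintegral_mono_ae ((hH.ae_mem_of_mem_insideAt hWUV).mono fun y hy => hle_p y hy.2)).trans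
        (hp.2 x ⟨hx, hxV⟩ W hWUV))
  · obtain ⟨W, hW⟩ := hH.exists_mem_insideAt (inter_mem hN (hU.mem_nhds hx))
    refine ⟨W, insideAt_mono inter_subset_left x hW, ?_⟩
    rw [piecewise_eq_of_notMem _ _ _ hxV]
    exact (lintegral_mono hle_q).trans (hq.2 x hx W (insideAt_mono inter_subset_right x hW))

theorem posHyperharmonicFor_piecewise_measure_add (hH : IsNormalBauerFamily 𝒱 H)
    [∀ x, Decidable (x ∈ V)] {K N O : Set X} (hK : IsClosed K) (hN : IsOpen N)
    (hV : V ∈ inside 𝒱 N) (hO : IsOpen O) {t : X → ENNReal}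
    (ht : PosHyperharmonicFor H (insideAt 𝒱 (N \ K)) (N \ K) t)
    (ht_frontier : ∀ x ∈ frontier V \ K, x ∉ O → 1 ≤ t x) :
    PosHyperharmonicFor H (insideAt 𝒱 Kᶜ) Kᶜ
      (V.piecewise (1 ⊓ ((fun x => H V x O) + t)) 1) := by
  have hVo := hH.isOpen hV.1
  have hKV : Kᶜ ∩ V ⊆ N \ K := fun x hx => ⟨hV.2 (subset_closure hx.2), hx.1⟩
  refine hH.posHyperharmonicFor_piecewise hK.isOpen_compl hVo (hH.posHyperharmonicFor_one _)
    (hH.posHyperharmonicFor_add (hH.posHyperharmonicFor_measure hV.1 inter_subset_right hO)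
      (ht.mono hKV fun x _ => insideAt_mono hKV x)) ?_
  rintro x ⟨hxK, hxV⟩ a ha
  refine eventually_nhdsWithin_of_eventually_nhds ?_
  by_cases hxO : x ∈ O
  · have hx : H V x O = 1 := by
      rw [(hH.boundary V hV.1).2 x (hVo.frontier_eq ▸ hxV).2, Measure.dirac_apply_of_mem hxO]
    filter_upwards [hH.lowerSemicontinuous_measure hV.1 hO x a (ha.trans_eq hx.symm)]
      with y hy using hy.trans_le le_self_add
  · have hxN : x ∈ N \ K := ⟨hV.2 (frontier_subset_closure hxV), hxK⟩
    filter_upwards [lowerSemicontinuousAt_of_isOpen ht.1 (hN.sdiff hK) hxN a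
      (ha.trans_le (ht_frontier x ⟨hxV, hxK⟩ hxO))] with y hy using hy.trans_le le_add_self

theorem exists_isCompact_measure_lt (hH : IsNormalBauerFamily 𝒱 H) {K : Set X} (hK : IsClosed K)
    (hV : V ∈ 𝒱) {z : X} (hz : z ∈ V) {ε : ENNReal} (hε : ε ≠ 0) :
    ∃ F ⊆ frontier V \ K, IsCompact F ∧ H V z (K ∪ F)ᶜ < ε := by
  have := hH.isProbabilityMeasure hV z
  obtain ⟨F, hF_sub, hF, hF_lt⟩ := (isClosed_frontier.measurableSet.diff
    hK.measurableSet).exists_isCompact_sdiff_lt (measure_ne_top (H V z) (frontier V \ K)) hε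
  refine ⟨F, hF_sub, hF, (measure_mono_ae ?_).trans_lt hF_lt⟩
  filter_upwards [hH.ae_mem_frontier hV hz] with y hy hyO
  exact ⟨⟨hy, fun h => hyO (Or.inl h)⟩, fun h => hyO (Or.inr h)⟩

theorem exists_barrier (hH : IsNormalBauerFamily 𝒱 H) {K N : Set X} (hK : IsClosed K)
    (hN : IsOpen N) (hV : V ∈ inside 𝒱 N) {z : X} (hzV : z ∈ V) {s : X → ENNReal}
    (hs : PosHyperharmonicFor H (insideAt 𝒱 (N \ K)) (N \ K) s) (hs_pos : ∀ x ∈ N \ K, 0 < s x)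
    (hs_lim : Tendsto s (𝓝[N \ K] z) (𝓝 0)) {ε : ENNReal} (hε : 0 < ε) :
    ∃ w, PosHyperharmonicFor H (insideAt 𝒱 Kᶜ) Kᶜ w ∧ (∀ x ∉ V, 1 ≤ w x) ∧
      ∀ᶠ x in 𝓝[Kᶜ] z, w x ≤ ε := by
  classical
  have hε2 := ENNReal.half_pos hε.ne'
  obtain ⟨F, hF_sub, hF, hz⟩ := hH.exists_isCompact_measure_lt hK hV.1 hzV hε2.ne'
  have hFN : F ⊆ N \ K :=
    hF_sub.trans (sdiff_subset_sdiff_left (frontier_subset_closure.trans hV.2))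
  obtain ⟨c, hc, hcF⟩ := exists_one_le_mul hF (hs.1.mono hFN) fun x hx => hs_pos x (hFN hx)
  have hO : IsOpen (K ∪ F)ᶜ := (hK.union hF.isClosed).isOpen_compl
  refine ⟨_, hH.posHyperharmonicFor_piecewise_measure_add hK hN hV hO (hs.const_mul hc)
    fun x hx hxO => hcF x ((not_not.1 hxO).resolve_left hx.2),
    fun x hx => (piecewise_eq_of_notMem V _ (1 : X → ENNReal) hx).ge, ?_⟩
  have hcs_lim : Tendsto (fun x => c * s x) (𝓝[N \ K] z) (𝓝 0) := by
    simpa only [mul_zero] using ENNReal.Tendsto.const_mul hs_lim (Or.inr hc)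
  have hcs_le := eventually_nhdsWithin_iff.1 (ENNReal.tendsto_nhds_zero.1 hcs_lim _ hε2)
  have hV_nhds := (hH.isOpen hV.1).mem_nhds hzV
  have hO_lt := ((hH.continuousOn_measure hV.1 hO.measurableSet).continuousAt
    hV_nhds).eventually_lt_const hz
  rw [eventually_nhdsWithin_iff]
  filter_upwards [hcs_le, hO_lt, hV_nhds] with x hxs hxO hxV hxK
  rw [piecewise_eq_of_mem _ _ _ hxV]
  calc 1 ⊓ (H V x (K ∪ F)ᶜ + c * s x) ≤ H V x (K ∪ F)ᶜ + c * s x := inf_le_right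
    _ ≤ ε / 2 + ε / 2 := add_le_add hxO.le (hxs ⟨hV.2 (subset_closure hxV), hxK⟩)
    _ = ε := ENNReal.add_halves ε

theorem tendsto_balayage (hH : IsNormalBauerFamily 𝒱 H) {B K N W : Set X} (hK : IsClosed K)
    (hN : IsOpen N) {z : X} (hzN : z ∈ N) (hzB : z ∉ closure B) {s : X → ENNReal}
    (hs : PosHyperharmonicFor H (insideAt 𝒱 (N \ K)) (N \ K) s) (hs_pos : ∀ x ∈ N \ K, 0 < s x)
    (hs_lim : Tendsto s (𝓝[N \ K] z) (𝓝 0)) :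
    Tendsto (balayage 𝒱 H (W \ K) B) (𝓝[W \ K] z) (𝓝 0) := by
  refine ENNReal.tendsto_nhds_zero.2 fun ε hε => ?_
  obtain ⟨V, hV⟩ := hH.exists_mem_insideAt
    (inter_mem (hN.mem_nhds hzN) (isClosed_closure.isOpen_compl.mem_nhds hzB))
  obtain ⟨w, hw, hwV, hwε⟩ := hH.exists_barrier hK hN (insideAt_mono inter_subset_left z hV).1
    hV.2 hs hs_pos hs_lim hε
  have hWK : W \ K ⊆ Kᶜ := fun x hx => hx.2
  have hle := hH.balayage_le (hw.mono hWK fun x _ => insideAt_mono hWK x) fun x hx =>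
    hwV x fun hxV => (hV.1.2 (subset_closure hxV)).2 (subset_closure hx)
  filter_upwards [nhdsWithin_mono z hWK hwε, self_mem_nhdsWithin] with x hxε hx
  exact (hle x hx).trans hxε

end IsNormalBauerFamily

end Barrier

section Components

variable {X : Type*} [TopologicalSpace X] {U V W K A : Set X}

theorem isConnected_of_mem_components (hV : V ∈ components U) : IsConnected V := by
  obtain ⟨x, hx, rfl⟩ := hV
  exact isConnected_connectedComponentIn_iff.2 hx

theorem subset_of_mem_components (hV : V ∈ components U) : V ⊆ U := by
  obtain ⟨x, -, rfl⟩ := hV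
  exact connectedComponentIn_subset U x

theorem exists_isOpen_closure_subset_sUnion [RegularSpace X] {𝒞 : Set (Set X)} (h𝒞 : 𝒞.Finite)
    (hopen : ∀ V ∈ 𝒞, IsOpen V) (hne : ∀ V ∈ 𝒞, V.Nonempty) :
    ∃ B, IsOpen B ∧ closure B ⊆ ⋃₀ 𝒞 ∧ ∀ V ∈ 𝒞, (V ∩ B).Nonempty := by
  have hex : ∀ V ∈ 𝒞, ∃ O, IsOpen O ∧ O.Nonempty ∧ closure O ⊆ V := fun V hV => by
    obtain ⟨x, hx⟩ := hne V hV
    obtain ⟨F, hFx, hF, hFV⟩ := exists_mem_nhds_isClosed_subset ((hopen V hV).mem_nhds hx)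
    exact ⟨interior F, isOpen_interior, ⟨x, mem_interior_iff_mem_nhds.2 hFx⟩,
      (closure_minimal interior_subset hF).trans hFV⟩
  choose! O hO hO_ne hOV using hex
  refine ⟨⋃ V ∈ 𝒞, O V, isOpen_biUnion hO, ?_, fun V hV => ?_⟩
  · rw [h𝒞.closure_biUnion]
    exact iUnion₂_subset fun V hV => (hOV V hV).trans (subset_sUnion_of_mem hV)
  · obtain ⟨x, hx⟩ := hO_ne V hV
    exact ⟨x, hOV V hV (subset_closure hx), mem_biUnion hV hx⟩

variable [LocallyConnectedSpace X]

theorem isOpen_of_mem_components (hU : IsOpen U) (hV : V ∈ components U) : IsOpen V := by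
  obtain ⟨x, -, rfl⟩ := hV
  exact hU.connectedComponentIn

theorem frontier_subset_of_mem_components (hU : IsOpen (W \ K)) (hV : V ∈ components (W \ K))
    (hVW : closure V ⊆ W) : frontier V ⊆ K := by
  obtain ⟨x, -, rfl⟩ := hV
  exact fun z hz => by_contra fun hzK => (disjoint_frontier_connectedComponentIn hU
    x).notMem_of_mem_left hz ⟨hVW (frontier_subset_closure hz), hzK⟩

theorem closure_subset_iff_frontier_subset (hU : IsOpen (W \ K)) (hKW : K ⊆ W)
    (hV : V ∈ components (W \ K)) : closure V ⊆ W ↔ frontier V ⊆ K := by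
  refine ⟨frontier_subset_of_mem_components hU hV, fun h => ?_⟩
  rw [closure_eq_self_union_frontier]
  exact union_subset ((subset_of_mem_components hV).trans sdiff_subset) (h.trans hKW)

theorem finite_components_inter {C : Set X} (hU : IsOpen U) (hC : IsCompact C) (hCU : C ⊆ U) :
    {V | V ∈ components U ∧ (V ∩ C).Nonempty}.Finite := by
  obtain ⟨t, -, ht⟩ := hC.elim_nhds_subcover (connectedComponentIn U) fun x hx =>
    connectedComponentIn_mem_nhds (hU.mem_nhds (hCU hx))
  refine (t.finite_toSet.image (connectedComponentIn U)).subset ?_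
  rintro _ ⟨⟨x, -, rfl⟩, y, hyx, hyC⟩
  obtain ⟨a, ha, hya⟩ := mem_iUnion₂.1 (ht hyC)
  exact ⟨a, ha, (connectedComponentIn_eq hya).trans (connectedComponentIn_eq hyx).symm⟩

theorem finite_components_inter_frontier (hU : IsOpen (W \ K)) (hA : IsOpen A)
    (hAc : IsCompact (closure A)) (hKA : K ⊆ A) (hAW : closure A ⊆ W) :
    {V | V ∈ components (W \ K) ∧ (V ∩ frontier A).Nonempty}.Finite :=
  finite_components_inter hU (hAc.of_isClosed_subset isClosed_frontier frontier_subset_closure)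
    fun _ hx => ⟨hAW (frontier_subset_closure hx), fun hxK =>
      hA.inter_frontier_eq.subset ⟨hKA hxK, hx⟩⟩

theorem finite_components_inter_of_finite_holes (hU : IsOpen (W \ K)) (hA : IsOpen A)
    (hAc : IsCompact (closure A)) (hKA : K ⊆ A) (hAW : closure A ⊆ W)
    (hfin : (holes W K).Finite) : {V | V ∈ components (W \ K) ∧ (V ∩ A).Nonempty}.Finite := by
  refine ((finite_components_inter_frontier hU hA hAc hKA hAW).union hfin).subset fun V hV => ?_
  by_cases hVA : Disjoint V (frontier A)
  · have hsub : closure V ⊆ closure A := closure_mono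
      (subset_of_disjoint_frontier (isConnected_of_mem_components hV.1).isPreconnected hA hV.2 hVA)
    exact Or.inr ⟨hV.1, hAc.of_isClosed_subset isClosed_closure hsub, hsub.trans hAW⟩
  · exact Or.inl ⟨hV.1, not_disjoint_iff_nonempty_inter.1 hVA⟩

end Components

section StronglyStable

variable {X : Type*} [TopologicalSpace X] [MeasurableSpace X] {𝒱 : Set (Set X)}
  {H : Set X → Kernel X X} {U U' : Set X}

theorem Harmonic.mono {h : X → ℝ} (hh : Harmonic 𝒱 H U h) (hU : U' ⊆ U) : Harmonic 𝒱 H U' h :=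
  ⟨hh.1.mono hU, fun V hV x hx => hh.2 V ⟨hV.1, hV.2.trans hU⟩ x (hU hx)⟩

theorem Hyperharmonic.mono {u : X → EReal} (hu : Hyperharmonic 𝒱 H U u) (hU : U' ⊆ U) :
    Hyperharmonic 𝒱 H U' u :=
  ⟨hu.1.mono hU, fun x hx => hu.2.1 x (hU hx),
    fun x hx W hW => hu.2.2 x (hU hx) W (insideAt_mono hU x hW)⟩

theorem IsPSet.mono (h : IsPSet 𝒱 H U) (hU' : IsOpen U') (hU : U' ⊆ U) : IsPSet 𝒱 H U' :=
  ⟨hU', fun x hx y hy hxy =>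
    let ⟨u, hu, hu0, hne⟩ := h.2 x (hU hx) y (hU hy) hxy
    ⟨u, Hyperharmonic.mono hu hU, fun z hz => hu0 z (hU hz), hne⟩⟩

namespace IsNormalBauerFamily

theorem harmonic_one (hH : IsNormalBauerFamily 𝒱 H) (U : Set X) : Harmonic 𝒱 H U fun _ => 1 := by
  refine ⟨continuousOn_const, fun V hV x _ => ?_⟩
  have := hH.isProbabilityMeasure hV.1 x
  rw [integral_const, probReal_univ, one_smul]

variable [T2Space X] [LocallyCompactSpace X] [SecondCountableTopology X] [BorelSpace X]
  {G K P W : Set X}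

theorem nonpos_of_harmonic (hH : IsNormalBauerFamily 𝒱 H) (hP : IsPSet 𝒱 H P)
    (hG : IsOpen G) (hGP : G ⊆ P) (hGc : IsCompact (closure G)) {h : X → ℝ}
    (hh : Harmonic 𝒱 H G h) (hlim : ∀ z ∈ frontier G, Tendsto h (𝓝[G] z) (𝓝 0)) :
    ∀ x ∈ G, h x ≤ 0 := fun x hx => by
  have hzero : PosHyperharmonicFor H (insideAt 𝒱 G) G 0 :=
    ⟨continuous_zero.lowerSemicontinuous.lowerSemicontinuousOn G, fun y _ W _ =>
      lintegral_zero.le⟩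
  refine ENNReal.ofReal_eq_zero.1 (nonpos_iff_eq_zero.1 ?_)
  refine hH.le_of_frontier hG hGc (hH.isSelection_insideAt hG)
    ((hH.posHyperharmonicSeparates_of_isPSet hP).mono hGP fun _ _ => insideAt_mono hGP _) hzero
    (f := fun y => ENNReal.ofReal (h y)) (ENNReal.continuous_ofReal.comp_continuousOn hh.1)
    (fun _ _ => ENNReal.ofReal_ne_top) (fun y hy W hW => ?_) (fun z hz ε hε => ?_) x hx
  · exact (congrArg ENNReal.ofReal (hh.2 W hW.1 y hy)).symm.trans_le
      (ofReal_integral_le_lintegral _ h)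
  · have hlim' : Tendsto (fun y => ENNReal.ofReal (h y)) (𝓝[G] z) (𝓝 0) :=
      ENNReal.ofReal_zero ▸ ENNReal.tendsto_ofReal (hlim z hz)
    exact (ENNReal.tendsto_nhds_zero.1 hlim' ε hε).mono fun y hy => hy.trans le_add_self

theorem frontier_nonempty (hH : IsNormalBauerFamily 𝒱 H) (hP : IsPSet 𝒱 H P) (hG : IsOpen G)
    (hGP : G ⊆ P) (hGc : IsCompact (closure G)) (hne : G.Nonempty) : (frontier G).Nonempty := by
  by_contra! hempty
  obtain ⟨x, hx⟩ := hne
  exact one_pos.not_ge (hH.nonpos_of_harmonic hP hG hGP hGc (hH.harmonic_one G)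
    (by simp only [hempty, mem_empty_iff_false, false_imp_iff, implies_true]) x hx)

theorem inter_nonempty_of_mem_holes (hH : IsNormalBauerFamily 𝒱 H) (hW : IsPSet 𝒱 H W)
    (hK : IsClosed K) {A V : Set X} (hA : IsOpen A) (hKA : K ⊆ A) (hV : V ∈ holes W K) :
    (V ∩ A).Nonempty := by
  have := hH.locallyConnectedSpace
  have hU : IsOpen (W \ K) := hW.1.sdiff hK
  obtain ⟨z, hz⟩ := hH.frontier_nonempty hW (isOpen_of_mem_components hU hV.1)
    (subset_closure.trans hV.2.2) hV.2.1 (isConnected_of_mem_components hV.1).nonempty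
  rw [inter_comm]
  exact mem_closure_iff.1 (frontier_subset_closure hz) A hA
    (hKA (frontier_subset_of_mem_components hU hV.1 hV.2.2 hz))

theorem not_subset_of_mem_holes (hH : IsNormalBauerFamily 𝒱 H) (hW : IsOpen W) (hK : IsClosed K)
    (hP : IsPSet 𝒱 H P) {h : X → ℝ} (hh : Harmonic 𝒱 H (P \ K) h) (hpos : ∀ x ∈ P \ K, 0 < h x)
    (hlim : ∀ z ∈ frontier K, Tendsto h (𝓝[P \ K] z) (𝓝 0)) {V : Set X} (hV : V ∈ holes W K) :
    ¬ V ⊆ P := fun hVP => by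
  have := hH.locallyConnectedSpace
  have hU : IsOpen (W \ K) := hW.sdiff hK
  have hVK : V ⊆ Kᶜ := fun x hx => (subset_of_mem_components hV.1 hx).2
  have hVPK : V ⊆ P \ K := subset_inter hVP hVK
  have hfrontier : frontier V ⊆ frontier K := fun z hz => by
    rw [frontier_eq_closure_inter_closure]
    exact ⟨subset_closure (frontier_subset_of_mem_components hU hV.1 hV.2.2 hz),
      closure_mono hVK (frontier_subset_closure hz)⟩
  obtain ⟨x, hx⟩ := (isConnected_of_mem_components hV.1).nonempty
  exact (hpos x (hVPK hx)).not_ge (hH.nonpos_of_harmonic hP (isOpen_of_mem_components hU hV.1) hVP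
    hV.2.1 (hh.mono hVPK)
    (fun z hz => (hlim z (hfrontier hz)).mono_left (nhdsWithin_mono z hVPK)) x hx)

theorem finite_holes (hH : IsNormalBauerFamily 𝒱 H) (hW : IsPSet 𝒱 H W) (hKW : K ⊆ W)
    (hK : IsStronglyStable 𝒱 H K) : (holes W K).Finite := by
  have := hH.locallyConnectedSpace
  obtain ⟨hKc, -, P, hP, hKP, h, hh, hpos, hlim⟩ := hK
  obtain ⟨A, hA, hKA, hAWP, hAc⟩ := exists_open_between_and_isCompact_closure hKc
    (hW.1.inter hP.1) (subset_inter hKW hKP)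
  refine (finite_components_inter_frontier (hW.1.sdiff hKc.isClosed) hA hAc hKA
    (hAWP.trans inter_subset_left)).subset fun V hV => ⟨hV.1, ?_⟩
  refine not_disjoint_iff_nonempty_inter.1 fun hdisj =>
    hH.not_subset_of_mem_holes hW.1 hKc.isClosed hP hh hpos hlim hV ?_
  exact (subset_of_disjoint_frontier (isConnected_of_mem_components hV.1).isPreconnected hA
    (hH.inter_nonempty_of_mem_holes hW hKc.isClosed hA hKA hV) hdisj).trans
      (subset_closure.trans (hAWP.trans inter_subset_right))

theorem tendsto_balayage_of_isStable (hH : IsNormalBauerFamily 𝒱 H) (hK : IsStable 𝒱 H K)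
    {B : Set X} {z : X} (hz : z ∈ frontier K) (hzB : z ∉ closure B) :
    Tendsto (balayage 𝒱 H (W \ K) B) (𝓝[W \ K] z) (𝓝 0) := by
  obtain ⟨N, hN, hzN, s, hs, hs_pos, hs_lim⟩ := hK.2.2 z hz
  refine hH.tendsto_balayage hK.1.isClosed hN hzN hzB
    (hH.posHyperharmonicFor_toENNReal (fun _ _ => Subset.rfl) hs.1 fun x hx => (hs_pos x hx).le)
    (fun x hx => EReal.toENNReal_pos_iff.2 (hs_pos x hx)) ?_
  exact EReal.toENNReal_zero ▸ (EReal.continuous_toENNReal.tendsto 0).comp hs_lim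

theorem isStronglyStable (hH : IsNormalBauerFamily 𝒱 H) (hell : IsElliptic 𝒱 H)
    (hW : IsPSet 𝒱 H W) (hKW : K ⊆ W) (hK : IsStable 𝒱 H K) (hne : K.Nonempty)
    (hfin : (holes W K).Finite) : IsStronglyStable 𝒱 H K := by
  have := hH.locallyConnectedSpace
  have hU : IsOpen (W \ K) := hW.1.sdiff hK.1.isClosed
  obtain ⟨A, hA, hKA, hAW, hAc⟩ := exists_open_between_and_isCompact_closure hK.1 hW.1 hKW
  obtain ⟨B, hB, hB_sub, hB_inter⟩ := exists_isOpen_closure_subset_sUnion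
    (finite_components_inter_of_finite_holes hU hA hAc hKA hAW hfin)
    (fun V hV => isOpen_of_mem_components hU hV.1)
    fun V hV => (isConnected_of_mem_components hV.1).nonempty
  have hBU : closure B ⊆ W \ K :=
    hB_sub.trans (sUnion_subset fun V hV => subset_of_mem_components hV.1)
  have hKB : ∀ z ∈ K, z ∉ closure B := fun z hzK hzB => (hBU hzB).2 hzK
  have hP : IsOpen (A \ closure B) := hA.sdiff isClosed_closure
  have hPW : A \ closure B ⊆ W := sdiff_subset.trans (subset_closure.trans hAW)
  have hPU : (A \ closure B) \ K ⊆ W \ K := sdiff_subset_sdiff_left hPW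
  refine ⟨hK.1, hne, A \ closure B, hW.mono hP hPW, fun x hx => ⟨hKA hx, hKB x hx⟩,
    fun x => (balayage 𝒱 H (W \ K) B x).toReal,
    hH.harmonic_balayage hU hB (hP.sdiff hK.1.isClosed) fun x hx => ⟨hPU hx, hx.1.2⟩,
    fun x hx => ?_, fun z hz => ?_⟩
  · have hx_comp : x ∈ connectedComponentIn (W \ K) x := mem_connectedComponentIn (hPU hx)
    exact ENNReal.toReal_pos (hH.balayage_pos hell hB hU.connectedComponentIn
      isPreconnected_connectedComponentIn (connectedComponentIn_subset _ _)
      (hB_inter _ ⟨⟨x, hPU hx, rfl⟩, x, hx_comp, hx.1.1⟩) x hx_comp).ne' (hH.balayage_ne_top x)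
  · exact (ENNReal.tendsto_toReal ENNReal.zero_ne_top).comp ((hH.tendsto_balayage_of_isStable hK hz
      (hKB z (hK.1.isClosed.frontier_subset hz))).mono_left (nhdsWithin_mono z hPU))

end IsNormalBauerFamily

end StronglyStable

end Bauer

theorem proposition5p4 {X : Type*} [TopologicalSpace X] [T2Space X] [LocallyCompactSpace X]
    [SecondCountableTopology X] [MeasurableSpace X] [BorelSpace X]
    (𝒱 : Set (Set X)) (H : Set X → Kernel X X)
    (hH : Bauer.IsNormalBauerFamily 𝒱 H) (hell : Bauer.IsElliptic 𝒱 H)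
    (W K : Set X) (hW : Bauer.IsPSet 𝒱 H W) (hKW : K ⊆ W)
    (hK : Bauer.IsStable 𝒱 H K) (hne : K.Nonempty) :
    (Bauer.IsStronglyStable 𝒱 H K ↔ (Bauer.holes W K).Finite) ∧
      ∀ V ∈ Bauer.components (W \ K),
        (IsCompact (closure V) ∧ closure V ⊆ W) ↔ (IsCompact (closure V) ∧ frontier V ⊆ K) := by
  have := hH.locallyConnectedSpace
  have hU : IsOpen (W \ K) := hW.1.sdiff hK.1.isClosed
  exact ⟨⟨hH.finite_holes hW hKW, hH.isStronglyStable hell hW hKW hK hne⟩, fun V hV =>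
    and_congr_right fun _ => Bauer.closure_subset_iff_frontier_subset hU hKW hV⟩
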